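/- Let $\mathsf V$ be the poset on $\{A,B,C\}$ whose cover relations are $A\lessdot B$ and $A\lessdot C$, and let $\ell\ge 1$ and $q\ge 3$ be integers. A $\mathsf V$-strict labeling of $\mathsf V\times[\ell]$ with labels in $[q]=\{1,\dots,q\}$ is a function $f:\mathsf V\times[\ell]\to[q]$ such that $f(p_1,i)<f(p_2,i)$ whenever $p_1<p_2$ in $\mathsf V$, and $f(p,i_1)\le f(p,i_2)$ whenever $i_1\le i_2$; let $\mathcal L$ be the set of these labelings. (For $p\in\mathsf V$, the values attained at $p$ by the elements of $\mathcal L$ form the interval $R^q(p)$, with $R^q(A)=[1,q-1]$ and $R^q(B)=R^q(C)=[2,q]$.) A label $f(p,i)$ is raisable (lowerable) if there is $g\in\mathcal L$ with $g(p,i)>f(p,i)$ (respectively $g(p,i)<f(p,i)$) and $g(p',i')=f(p',i')$ for all $p'\ne p$ and all $i'$. For $1\le k\le q-1$, the $k$-th Bender–Knuth involution $\tau_k:\mathcal L\to\mathcal L$ acts as follows: call the raisable labels equal to $k$ and the lowerable labels equal to $k+1$ free; for each $p\in\mathsf V$, if the labels $f(p,1),\dots,f(p,\ell)$ include $a$ free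 labels $k$ followed by $b$ free labels $k+1$, then $\tau_k$ replaces these by $b$ labels $k$ followed by $a$ labels $k+1$, and all other labels are unchanged. $P$-strict promotion is $\mathrm{Pro}=\tau_{q-1}\circ\cdots\circ\tau_2\circ\tau_1$. Theorem. The order of $\mathrm{Pro}$ on $\mathcal L$ divides $2q$. More precisely, $\mathrm{Pro}^q$ exchanges the roles of $B$ and $C$: for every $f\in\mathcal L$ and $i\in[\ell]$, $(\mathrm{Pro}^q f)(A,i)=f(A,i)$, $(\mathrm{Pro}^q f)(B,i)=f(C,i)$ and $(\mathrm{Pro}^q f)(C,i)=f(B,i)$. -/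

import Mathlib

/-- The elements of the poset `V`. -/
inductive VPoset where
  | A
  | B
  | C
  deriving DecidableEq

namespace VPoset

instance : Fintype VPoset := ⟨{A, B, C}, fun x => by cases x <;> decide⟩

/-- The order of `V`: `A` lies below everything, and `B`, `C` are incomparable. -/
instance : PartialOrder VPoset where
  le x y := x = A ∨ x = y
  le_refl x := Or.inr rfl
  le_trans x y z := by rintro (h | rfl) (h' | rfl) <;> simp_all
  le_antisymm x y := by rintro (h | rfl) (h' | h') <;> simp_all

theorem le_def (x y : VPoset) : x ≤ y ↔ x = A ∨ x = y := Iff.rfl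

theorem lt_def (x y : VPoset) : x < y ↔ x = A ∧ y ≠ A := by
  rw [lt_iff_le_not_ge, le_def, le_def]
  cases x <;> cases y <;> simp

/-- The cover relations of `V` are exactly `A ⋖ B` and `A ⋖ C`. -/
theorem covBy_iff (x y : VPoset) : x ⋖ y ↔ (x = A ∧ y = B) ∨ (x = A ∧ y = C) := by
  unfold CovBy
  simp only [lt_def]
  cases x <;> cases y <;> simp +contextual

end VPoset

/-- A `P`-strict labeling of `P × [ℓ]` with restriction function `R`; the value `f p i` is the
label of `(p, i)`, and the index set `[ℓ]` is `Fin ℓ`. -/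
@[ext]
structure PStrictLabeling (P : Type*) [PartialOrder P] (ℓ : ℕ) (R : P → Finset ℤ) where
  label : P → Fin ℓ → ℤ
  strict : ∀ p₁ p₂ : P, p₁ < p₂ → ∀ i, label p₁ i < label p₂ i
  weak : ∀ (p : P) (i₁ i₂ : Fin ℓ), i₁ ≤ i₂ → label p i₁ ≤ label p i₂
  mem : ∀ (p : P) (i : Fin ℓ), label p i ∈ R p

namespace PStrictLabeling

/-- `R(p)_{>k}`, the smallest element of `R p` larger than `k`; it is `⊤` if there is none. -/
def nextLabel {P : Type*} (R : P → Finset ℤ) (p : P) (k : ℤ) : WithTop ℤ :=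
  ((R p).filter (fun m => k < m)).min

theorem nextLabel_eq_coe {P : Type*} {R : P → Finset ℤ} {p : P} {k m : ℤ} :
    nextLabel R p k = (m : WithTop ℤ) ↔ m ∈ R p ∧ k < m ∧ ∀ x ∈ R p, k < x → m ≤ x := by
  unfold nextLabel
  constructor
  · intro h
    have h1 := Finset.mem_filter.1 (Finset.mem_of_min h)
    exact ⟨h1.1, h1.2, fun x hx hkx => Finset.min_le_of_eq (Finset.mem_filter.2 ⟨hx, hkx⟩) h⟩
  · rintro ⟨h1, h2, h3⟩
    refine le_antisymm (Finset.min_le (Finset.mem_filter.2 ⟨h1, h2⟩)) (Finset.le_min ?_)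
    intro x hx
    exact WithTop.coe_le_coe.2 (h3 x (Finset.mem_filter.1 hx).1 (Finset.mem_filter.1 hx).2)

variable {P : Type*} [PartialOrder P] {ℓ : ℕ} {R : P → Finset ℤ}

instance : CoeFun (PStrictLabeling P ℓ R) (fun _ => P → Fin ℓ → ℤ) := ⟨label⟩

/-- `R` is consistent with respect to `P × [ℓ]`: every value that it allows is attained. -/
def Consistent (P : Type*) [PartialOrder P] (ℓ : ℕ) (R : P → Finset ℤ) : Prop :=
  ∀ p : P, ∀ k ∈ R p, ∃ (f : PStrictLabeling P ℓ R) (i : Fin ℓ), f p i = k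

open Classical in
/-- The consistent restriction function `R_a^b` induced by lower and upper bounds `a`, `b`: the
values in `[a p, b p]` that are attained at `p` by a labeling which obeys the bounds. It is the
largest consistent restriction function within the bounds, see `consistent_boundRestriction` and
`Consistent.subset_boundRestriction`. -/
noncomputable def boundRestriction (P : Type*) [PartialOrder P] (ℓ : ℕ) (a b : P → ℤ) (p : P) :
    Finset ℤ :=
  {k ∈ Finset.Icc (a p) (b p) |
    ∃ (f : PStrictLabeling P ℓ (fun p' => Finset.Icc (a p') (b p'))) (i : Fin ℓ), f p i = k}

theorem mem_boundRestriction {a b : P → ℤ} {p : P} {k : ℤ} :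
    k ∈ boundRestriction P ℓ a b p ↔ k ∈ Finset.Icc (a p) (b p) ∧
      ∃ (f : PStrictLabeling P ℓ (fun p' => Finset.Icc (a p') (b p'))) (i : Fin ℓ), f p i = k := by
  classical
  exact Finset.mem_filter

theorem consistent_boundRestriction (a b : P → ℤ) :
    Consistent P ℓ (boundRestriction P ℓ a b) := by
  intro p k hk
  obtain ⟨-, f, i, hf⟩ := mem_boundRestriction.1 hk
  exact ⟨⟨f.label, f.strict, f.weak,
    fun p' i' => mem_boundRestriction.2 ⟨f.mem p' i', f, i', rfl⟩⟩, i, hf⟩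

theorem Consistent.subset_boundRestriction {a b : P → ℤ} (hR : Consistent P ℓ R)
    (h : ∀ p, R p ⊆ Finset.Icc (a p) (b p)) (p : P) : R p ⊆ boundRestriction P ℓ a b p := by
  intro k hk
  obtain ⟨f, i, hf⟩ := hR p k hk
  exact mem_boundRestriction.2 ⟨h p hk,
    ⟨f.label, f.strict, f.weak, fun p' i' => h p' (f.mem p' i')⟩, i, hf⟩

/-- The restriction function `R^q`, induced by the constant bounds `1` and `q`. -/
noncomputable def restrictionQ (P : Type*) [PartialOrder P] (ℓ q : ℕ) : P → Finset ℤ :=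
  boundRestriction P ℓ (fun _ => 1) (fun _ => (q : ℤ))

theorem restrictionQ_subset (q : ℕ) (p : P) : restrictionQ P ℓ q p ⊆ Finset.Icc 1 (q : ℤ) :=
  fun _ hk => (mem_boundRestriction.1 hk).1

/-- For `V`, the labels at `A` range over `[1, q - 1]`, those at `B` and `C` over `[2, q]`. -/
theorem restrictionQ_VPoset (hℓ : 1 ≤ ℓ) (q : ℕ) (p : VPoset) :
    restrictionQ VPoset ℓ q p =
      if p = VPoset.A then Finset.Icc 1 ((q : ℤ) - 1) else Finset.Icc 2 (q : ℤ) := by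
  ext k
  constructor
  · intro hk
    obtain ⟨-, f, i, hf⟩ := mem_boundRestriction.1 hk
    have hA := Finset.mem_Icc.1 (f.mem VPoset.A i)
    have hB := Finset.mem_Icc.1 (f.mem VPoset.B i)
    have hC := Finset.mem_Icc.1 (f.mem VPoset.C i)
    have hAB := f.strict VPoset.A VPoset.B (by simp [VPoset.lt_def]) i
    have hAC := f.strict VPoset.A VPoset.C (by simp [VPoset.lt_def]) i
    cases p <;> simp at * <;> omega
  · intro hk
    have hk' : 1 ≤ k ∧ k ≤ q ∧ (p = VPoset.A → k ≤ q - 1) ∧ (p ≠ VPoset.A → 2 ≤ k) := by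
      cases p <;> simp at * <;> omega
    refine mem_boundRestriction.2 ⟨Finset.mem_Icc.2 ⟨hk'.1, hk'.2.1⟩,
      ⟨fun p' _ => if p' = VPoset.A then (if p = VPoset.A then k else 1)
        else (if p = VPoset.A then q else k), ?_, ?_, ?_⟩, ⟨0, hℓ⟩, ?_⟩
    · intro p₁ p₂ h i
      rw [VPoset.lt_def] at h
      cases p <;> simp_all <;> omega
    · intros; exact le_rfl
    · intro p' i
      cases p <;> cases p' <;> simp at * <;> omega
    · cases p <;> simp

/-- The label `f p i` is raisable: some labeling that agrees with `f` outside the fiber of `p`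
has a larger label at `(p, i)`. -/
def Raisable (f : PStrictLabeling P ℓ R) (p : P) (i : Fin ℓ) : Prop :=
  ∃ g : PStrictLabeling P ℓ R, f p i < g p i ∧ ∀ p', p' ≠ p → ∀ i', f p' i' = g p' i'

/-- The label `f p i` is lowerable. -/
def Lowerable (f : PStrictLabeling P ℓ R) (p : P) (i : Fin ℓ) : Prop :=
  ∃ g : PStrictLabeling P ℓ R, g p i < f p i ∧ ∀ p', p' ≠ p → ∀ i', f p' i' = g p' i'

/-- `f p i` is a free label equal to `k`. -/
def FreeLow (f : PStrictLabeling P ℓ R) (k : ℤ) (p : P) (i : Fin ℓ) : Prop :=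
  f p i = k ∧ f.Raisable p i

/-- `f p i` is a free label equal to `R(p)_{>k}`. The condition `k ∈ R p` says that `k` is an
admissible label at `p`; when `R p` is an interval it is implied by the other two. -/
def FreeHigh (f : PStrictLabeling P ℓ R) (k : ℤ) (p : P) (i : Fin ℓ) : Prop :=
  k ∈ R p ∧ (f p i : WithTop ℤ) = nextLabel R p k ∧ f.Lowerable p i

/-- `f p i` is one of the labels that the `k`-th Bender–Knuth involution may change. -/
def Free (f : PStrictLabeling P ℓ R) (k : ℤ) (p : P) (i : Fin ℓ) : Prop :=
  f.FreeLow k p i ∨ f.FreeHigh k p i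

open Classical in
/-- The labels after the `k`-th Bender–Knuth involution: if the fiber of `p` has `a` free labels
`k` and `b` free labels `R(p)_{>k}`, then its first `b` free labels become `k` and the remaining
`a` ones become `R(p)_{>k}`; the other labels stay. (The default value in `untopD` is never used:
if some free label equals `k`, then `R(p)_{>k}` exists.) -/
noncomputable def tauLabel (k : ℤ) (f : PStrictLabeling P ℓ R) (p : P) (i : Fin ℓ) : ℤ :=
  if f.Free k p i then
    if Finset.card {j : Fin ℓ | j < i ∧ f.Free k p j} < Finset.card {j : Fin ℓ | f.FreeHigh k p j}
    then k
    else (nextLabel R p k).untopD k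
  else f p i

/-- What a free label looks like, before and after. -/
theorem Free.spec {k : ℤ} {f : PStrictLabeling P ℓ R} {p : P} {i : Fin ℓ} (h : f.Free k p i) :
    k ∈ R p ∧ ∃ m : ℤ, nextLabel R p k = (m : WithTop ℤ) ∧ (f p i = k ∨ f p i = m) ∧
      (tauLabel k f p i = k ∨ tauLabel k f p i = m) := by
  have key : k ∈ R p ∧ ∃ m : ℤ, nextLabel R p k = (m : WithTop ℤ) ∧ (f p i = k ∨ f p i = m) := by
    rcases h with ⟨h1, g, hg, -⟩ | ⟨h1, h2, -⟩
    · refine ⟨h1 ▸ f.mem p i, ?_⟩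
      have hne : ((R p).filter (fun m => k < m)).Nonempty :=
        ⟨g p i, Finset.mem_filter.2 ⟨g.mem p i, h1 ▸ hg⟩⟩
      obtain ⟨m, hm⟩ := Finset.min_of_nonempty hne
      exact ⟨m, hm, Or.inl h1⟩
    · exact ⟨h1, f p i, h2.symm, Or.inr rfl⟩
  obtain ⟨hk, m, hm, hf⟩ := key
  refine ⟨hk, m, hm, hf, ?_⟩
  unfold tauLabel
  rw [if_pos h, hm]
  split_ifs
  · exact Or.inl rfl
  · exact Or.inr rfl

theorem tauLabel_of_not_free {k : ℤ} {f : PStrictLabeling P ℓ R} {p : P} {i : Fin ℓ}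
    (h : ¬ f.Free k p i) : tauLabel k f p i = f p i := if_neg h

/-- The `k`-th Bender–Knuth involution `τ_k`. -/
noncomputable def tau (k : ℤ) (f : PStrictLabeling P ℓ R) : PStrictLabeling P ℓ R where
  label := tauLabel k f
  strict p₁ p₂ h12 i := by
    have hf := f.strict p₁ p₂ h12 i
    have hup : tauLabel k f p₁ i ≤ f p₁ i ∨ f.FreeLow k p₁ i := by
      by_cases h : f.Free k p₁ i
      · obtain ⟨-, m, hm, h₁, h₂⟩ := h.spec
        have hkm := (nextLabel_eq_coe.1 hm).2.1
        rcases h with h | h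
        · exact Or.inr h
        · have : f p₁ i = m := by
            have h' := h.2.1
            rw [hm] at h'
            exact WithTop.coe_injective h'
          left; omega
      · left; rw [tauLabel_of_not_free h]
    have hdown : f p₂ i ≤ tauLabel k f p₂ i ∨ f.FreeHigh k p₂ i := by
      by_cases h : f.Free k p₂ i
      · obtain ⟨-, m, hm, h₁, h₂⟩ := h.spec
        have hkm := (nextLabel_eq_coe.1 hm).2.1
        rcases h with h | h
        · have := h.1
          left; omega
        · exact Or.inr h
      · left; rw [tauLabel_of_not_free h]
    have hlow : f.FreeHigh k p₂ i → f p₁ i < k := by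
      rintro ⟨hk, hm, g, hg, hgf⟩
      have hm' := nextLabel_eq_coe.1 hm.symm
      have e := hgf p₁ h12.ne i
      have hgs := g.strict p₁ p₂ h12 i
      have hgk : g p₂ i ≤ k := by
        by_contra hc
        have := hm'.2.2 _ (g.mem p₂ i) (not_le.1 hc)
        omega
      omega
    rcases hup with hup | hup
    · rcases hdown with hdown | hdown
      · omega
      · have h1 := hlow hdown
        obtain ⟨-, m, hm, -, h₂⟩ := Free.spec (Or.inr hdown)
        have hkm := (nextLabel_eq_coe.1 hm).2.1
        omega
    · rcases hdown with hdown | hdown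
      · obtain ⟨-, m, hm, -, h₂⟩ := Free.spec (Or.inl hup)
        have hm' := nextLabel_eq_coe.1 hm
        obtain ⟨h1, g, hg, hgf⟩ := hup
        have e := hgf p₂ h12.ne' i
        have hgs := g.strict p₁ p₂ h12 i
        have := hm'.2.2 _ (g.mem p₁ i) (by omega)
        omega
      · have h1 := hlow hdown
        have := hup.1
        omega
  weak p i j hij := by
    have hf := f.weak p i j hij
    by_cases hi : f.Free k p i <;> by_cases hj : f.Free k p j
    · obtain ⟨-, m, hm, -, -⟩ := hi.spec
      have hkm := (nextLabel_eq_coe.1 hm).2.1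
      classical
      have hcard : Finset.card {x : Fin ℓ | x < i ∧ f.Free k p x} ≤
          Finset.card {x : Fin ℓ | x < j ∧ f.Free k p x} := by
        refine Finset.card_le_card fun x hx => ?_
        simp only [Finset.mem_filter, Finset.mem_univ, true_and] at hx ⊢
        exact ⟨hx.1.trans_le hij, hx.2⟩
      unfold tauLabel
      rw [if_pos hi, if_pos hj, hm]
      split_ifs with h₁ h₂ h₂
      · exact le_rfl
      · exact hkm.le
      · omega
      · exact le_rfl
    · obtain ⟨-, m, hm, h₁, h₂⟩ := hi.spec
      have hm' := nextLabel_eq_coe.1 hm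
      rw [tauLabel_of_not_free hj]
      have hjk : f p j ≠ k := by
        intro hjk
        rcases hi with ⟨hik, g, hg, hgf⟩ | ⟨-, h, -⟩
        · exact hj (Or.inl ⟨hjk, g, by have := g.weak p i j hij; omega, hgf⟩)
        · rw [hm] at h
          have := WithTop.coe_injective h
          omega
      have := hm'.2.2 _ (f.mem p j) (by omega)
      omega
    · obtain ⟨hk, m, hm, h₁, h₂⟩ := hj.spec
      have hm' := nextLabel_eq_coe.1 hm
      rw [tauLabel_of_not_free hi]
      have him : f p i ≠ m := by
        intro him
        have hjm : f p j = m := by omega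
        rcases hj with ⟨hjk, -⟩ | ⟨-, -, g, hg, hgf⟩
        · omega
        · exact hi (Or.inr ⟨hk, by rw [him, hm], g, by have := g.weak p i j hij; omega, hgf⟩)
      have hik : f p i ≤ k := by
        by_contra hc
        have := hm'.2.2 _ (f.mem p i) (not_le.1 hc)
        omega
      omega
    · rw [tauLabel_of_not_free hi, tauLabel_of_not_free hj]; exact hf
  mem p i := by
    by_cases h : f.Free k p i
    · obtain ⟨hk, m, hm, -, h' | h'⟩ := h.spec <;> rw [h']
      · exact hk
      · exact (nextLabel_eq_coe.1 hm).1
    · rw [tauLabel_of_not_free h]; exact f.mem p i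

/-- `τ_k` acts trivially on labelings with labels in `[1, q]` unless `1 ≤ k ≤ q - 1`. -/
theorem tau_eq_self {q : ℕ} (hR : ∀ p, R p ⊆ Finset.Icc 1 (q : ℤ)) {k : ℤ}
    (hk : ¬ (1 ≤ k ∧ k ≤ (q : ℤ) - 1)) (f : PStrictLabeling P ℓ R) : tau k f = f := by
  apply PStrictLabeling.ext
  funext p i
  refine tauLabel_of_not_free fun h => hk ?_
  obtain ⟨h₁, m, hm, -⟩ := h.spec
  have hm' := nextLabel_eq_coe.1 hm
  have h1 := Finset.mem_Icc.1 (hR p h₁)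
  have h2 := Finset.mem_Icc.1 (hR p hm'.1)
  omega

/-- The composite `τ_n ∘ ⋯ ∘ τ_2 ∘ τ_1`. -/
noncomputable def tauComposite : ℕ → PStrictLabeling P ℓ R → PStrictLabeling P ℓ R
  | 0, f => f
  | n + 1, f => tau ((n : ℤ) + 1) (tauComposite n f)

/-- `P`-strict promotion `Pro = τ_{q-1} ∘ ⋯ ∘ τ_2 ∘ τ_1` on the `P`-strict labelings with restriction
function `R^q`, as an element of the monoid of self-maps. All other `τ_k`, `k ∈ ℤ`, are trivial
here by `tau_eq_self`. -/
noncomputable def promotion (P : Type*) [PartialOrder P] (ℓ q : ℕ) :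
    Function.End (PStrictLabeling P ℓ (restrictionQ P ℓ q)) :=
  tauComposite (q - 1)

end PStrictLabeling

/-! A labeling is determined by the numbers of labels at most `k` on its three fibers. Encode it by
a word: for `k = 1, …, q` write a `b` or `c` for each label `k` at `B` or `C`, then an `a` for each
label `k` at `A`, then a bar. Strictness says that every prefix has at least as many `a` as `b` and
at least as many `a` as `c`. Think of each `b`, and each `c`, as matched with the last `a` still
unmatched for that letter. When the next `b` and `c` of a block would be matched with the same `a`,
they are merged into a `d`; otherwise the matching prescribes their order.

On words, a promotion step removes a leading `a`, writes `a` over the first letter `X` at which one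
of the two excesses drops to zero, and appends `X`; a leading bar just moves to the end. The
positions of the bars therefore rotate, one application of `Pro` is the run of steps up to and
including a bar (`MidRow.hit`, `MidRow.bar`), and `q` applications are as many steps as the word has
letters. The link is made on counts: the Bender–Knuth involutions give a piecewise linear recursion
with a unique solution (`PromotionRow`, `numLe_tau_A`, `numLe_tau_of_ne_A`), and the word steps
satisfy the same recursion as long as the word is `Standard`, a condition that steps preserve
(`Standard.step`).

What remains is `steps_sw`: in as many steps as it has letters, a word turns into itself with `b`
and `c` exchanged. It is proved by induction on the length, for the class of `Good` words, which
allows letters to be deleted. A closed piece (a bar, `ad` or `abc`) can be taken out: the other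
letters are promoted as if it were absent, and when it comes first it travels to the end and is
mirrored on the way (`steps_sw_insert`). If no bar or `ad` is available, the last `a` is followed by
a run of `b` and then a `c`, or the mirror image, and the `c` must be moved left past all but the
first `b` to create `abc`.

Such a move is justified by `steps_sw_of_cross`. Promote the words `x c b y` and `x b c y` side by
side. They differ only in one of three local patterns (`Uncross`) until the pattern comes first; two
more steps then turn it into the mirror image of the original pair, at the end of the words
(`Uncross.turn`). So if one of the words comes back mirrored, so does the other. -/

/-! ### Words, heights and the symmetry between `b` and `c` -/

/-- Letters of the words that encode labelings of `V × [ℓ]`: a letter `d` is a `b` merged with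
a `c`, and `bar` ends the block of all letters with a given label. -/
inductive Letter where
  | a
  | b
  | c
  | d
  | bar
  deriving DecidableEq

namespace Letter

/-- The contribution of a letter to the excess of `a` over `b`. -/
def u : Letter → ℤ
  | a => 1
  | b => -1
  | c => 0
  | d => -1
  | bar => 0

/-- The contribution of a letter to the excess of `a` over `c`. -/
def v : Letter → ℤ
  | a => 1
  | b => 0
  | c => -1
  | d => -1
  | bar => 0

/-- Exchange of `b` and `c`. -/
def swap : Letter → Letter
  | b => c
  | c => b
  | x => x

@[simp] theorem u_a : a.u = 1 := rfl
@[simp] theorem u_b : b.u = -1 := rfl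
@[simp] theorem u_c : c.u = 0 := rfl
@[simp] theorem u_d : d.u = -1 := rfl
@[simp] theorem u_bar : bar.u = 0 := rfl
@[simp] theorem v_a : a.v = 1 := rfl
@[simp] theorem v_b : b.v = 0 := rfl
@[simp] theorem v_c : c.v = -1 := rfl
@[simp] theorem v_d : d.v = -1 := rfl
@[simp] theorem v_bar : bar.v = 0 := rfl
@[simp] theorem swap_a : a.swap = a := rfl
@[simp] theorem swap_b : b.swap = c := rfl
@[simp] theorem swap_c : c.swap = b := rfl
@[simp] theorem swap_d : d.swap = d := rfl
@[simp] theorem swap_bar : bar.swap = bar := rfl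

@[simp] theorem u_swap (x : Letter) : x.swap.u = x.v := by cases x <;> rfl
@[simp] theorem v_swap (x : Letter) : x.swap.v = x.u := by cases x <;> rfl
@[simp] theorem swap_swap (x : Letter) : x.swap.swap = x := by cases x <;> rfl

end Letter

namespace VWord

open Letter

/-- The excess of `a` over `b` in a word. -/
def hB (w : List Letter) : ℤ := (w.map u).sum

/-- The excess of `a` over `c` in a word. -/
def hC (w : List Letter) : ℤ := (w.map v).sum

@[simp] theorem hB_nil : hB [] = 0 := rfl
@[simp] theorem hC_nil : hC [] = 0 := rfl
@[simp] theorem hB_cons (x : Letter) (w) : hB (x :: w) = x.u + hB w := by simp [hB]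
@[simp] theorem hC_cons (x : Letter) (w) : hC (x :: w) = x.v + hC w := by simp [hC]
@[simp] theorem hB_append (w w') : hB (w ++ w') = hB w + hB w' := by simp [hB]
@[simp] theorem hC_append (w w') : hC (w ++ w') = hC w + hC w' := by simp [hC]

/-- Exchange of `b` and `c` in a word. -/
def sw (w : List Letter) : List Letter := w.map swap

@[simp] theorem sw_nil : sw [] = [] := rfl
@[simp] theorem sw_cons (x w) : sw (x :: w) = x.swap :: sw w := rfl
@[simp] theorem sw_append (w w') : sw (w ++ w') = sw w ++ sw w' := by simp [sw]
@[simp] theorem sw_sw (w) : sw (sw w) = w := by simp [sw, Function.comp_def]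
@[simp] theorem length_sw (w) : (sw w).length = w.length := by simp [sw]
@[simp] theorem hB_sw (w) : hB (sw w) = hC w := by simp [sw, hB, hC, Function.comp_def]
@[simp] theorem hC_sw (w) : hC (sw w) = hB w := by simp [sw, hB, hC, Function.comp_def]

theorem sw_suffix {s w : List Letter} (h : s <:+ w) : sw s <:+ sw w := by
  obtain ⟨p, rfl⟩ := h; exact ⟨sw p, by simp⟩

/-- The heights stay nonnegative along a word when they start at `i` and `j`. -/
def Safe (i j : ℤ) : List Letter → Prop
  | [] => 0 ≤ i ∧ 0 ≤ j
  | x :: w => 0 ≤ i ∧ 0 ≤ j ∧ Safe (i + x.u) (j + x.v) w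

@[simp] theorem safe_nil {i j : ℤ} : Safe i j [] ↔ 0 ≤ i ∧ 0 ≤ j := Iff.rfl
@[simp] theorem safe_cons {i j : ℤ} {x w} :
    Safe i j (x :: w) ↔ 0 ≤ i ∧ 0 ≤ j ∧ Safe (i + x.u) (j + x.v) w := Iff.rfl

theorem Safe.start {i j : ℤ} {w} (h : Safe i j w) : 0 ≤ i ∧ 0 ≤ j := by
  cases w with
  | nil => exact h
  | cons x w => exact ⟨h.1, h.2.1⟩

@[simp] theorem safe_append {w w' : List Letter} : ∀ {i j : ℤ},
    Safe i j (w ++ w') ↔ Safe i j w ∧ Safe (i + hB w) (j + hC w) w' := by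
  induction w with
  | nil => intro i j; simpa using fun h => Safe.start h
  | cons x w ih => intro i j; simp [ih, and_assoc, add_assoc]

theorem Safe.last {w : List Letter} : ∀ {i j : ℤ}, Safe i j w → 0 ≤ i + hB w ∧ 0 ≤ j + hC w := by
  induction w with
  | nil => intro i j h; simpa using h
  | cons x w ih => intro i j h; simpa [add_assoc] using ih h.2.2

theorem Safe.mono {w : List Letter} : ∀ {i j i' j' : ℤ}, Safe i j w → i ≤ i' → j ≤ j' →
    Safe i' j' w := by
  induction w with
  | nil => intro i j i' j' h h1 h2; exact ⟨h.1.trans h1, h.2.trans h2⟩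
  | cons x w ih =>
    intro i j i' j' h h1 h2
    exact ⟨h.1.trans h1, h.2.1.trans h2, ih h.2.2 (by omega) (by omega)⟩

theorem safe_sw {w : List Letter} : ∀ {i j : ℤ}, Safe i j (sw w) ↔ Safe j i w := by
  induction w with
  | nil => intro i j; simp [and_comm]
  | cons x w ih => intro i j; simp [ih]; tauto

/-! ### Unmatched letters `a` and good words -/

/-- Some suffix of `p` reaches a positive height of `a` over `b`, and none of its suffixes has a
positive height of `a` over `c`: the last unmatched `a` is unmatched for `b` only. -/
def LateB (p : List Letter) : Prop :=
  ∃ t, t <:+ p ∧ 1 ≤ hB t ∧ ∀ t', t' <:+ t → hC t' ≤ 0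

/-- The last unmatched `a` of `p` is unmatched for `c` only. -/
def LateC (p : List Letter) : Prop :=
  ∃ t, t <:+ p ∧ 1 ≤ hC t ∧ ∀ t', t' <:+ t → hB t' ≤ 0

theorem lateB_sw {p : List Letter} : LateB (sw p) ↔ LateC p := by
  constructor
  · rintro ⟨t, h1, h2, h3⟩
    refine ⟨sw t, by simpa using sw_suffix h1, by simpa using h2, fun t' ht' => ?_⟩
    simpa using h3 (sw t') (by simpa using sw_suffix ht')
  · rintro ⟨t, h1, h2, h3⟩
    refine ⟨sw t, sw_suffix h1, by simpa using h2, fun t' ht' => ?_⟩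
    simpa using h3 (sw t') (by simpa using sw_suffix ht')

theorem lateC_sw {p : List Letter} : LateC (sw p) ↔ LateB p := by
  rw [← lateB_sw, sw_sw]

theorem LateB.mono {p q : List Letter} (h : LateB p) (hpq : p <:+ q) : LateB q := by
  obtain ⟨t, h1, h2⟩ := h; exact ⟨t, h1.trans hpq, h2⟩

theorem LateC.mono {p q : List Letter} (h : LateC p) (hpq : p <:+ q) : LateC q := by
  obtain ⟨t, h1, h2⟩ := h; exact ⟨t, h1.trans hpq, h2⟩

theorem LateC.of_bar {p : List Letter} (h : LateC (bar :: p)) : LateC p := by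
  obtain ⟨t, h1, h2, h3⟩ := h
  rcases List.suffix_cons_iff.1 h1 with rfl | h1
  · exact ⟨p, List.suffix_rfl, by simpa using h2,
      fun t' ht' => h3 t' (ht'.trans (List.suffix_cons _ _))⟩
  · exact ⟨t, h1, h2, h3⟩

theorem LateB.of_bar {p : List Letter} (h : LateB (bar :: p)) : LateB p := by
  rw [← lateC_sw] at h ⊢; exact LateC.of_bar h

/-- Words that encode labelings: heights are nonnegative and return to `0`, and the `b` and `c`
merged into a letter `d` are matched with the same `a`. -/
structure Good (w : List Letter) : Prop where
  safe : Safe 0 0 w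
  hB_eq : hB w = 0
  hC_eq : hC w = 0
  merged : ∀ p s, w = p ++ d :: s → ¬ LateB p ∧ ¬ LateC p

theorem Good.sw {w : List Letter} (h : Good w) : Good (sw w) where
  safe := safe_sw.2 h.safe
  hB_eq := by simpa using h.hC_eq
  hC_eq := by simpa using h.hB_eq
  merged p s e := by
    have := h.merged (VWord.sw p) (VWord.sw s) (by rw [← sw_sw w, e]; simp)
    rw [lateB_sw, lateC_sw] at this
    exact this.symm

/-! ### Promotion steps on words -/

/-- The letter `X` ends a shortest nonempty prefix of `a :: x ++ [X]` of height `0`. -/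
structure Hit (x : List Letter) (X : Letter) : Prop where
  safe : Safe 0 0 x
  hit : hB x + X.u = -1 ∨ hC x + X.v = -1

/-- One step of promotion on words: the first letter is removed. If it is an `a`, then it replaces
the first letter that it cannot pass, and that letter is appended to the word. -/
inductive Step : List Letter → List Letter → Prop
  | bar (x) : Step (Letter.bar :: x) (x ++ [Letter.bar])
  | hit {x X z} (h : Hit x X) : Step (a :: (x ++ X :: z)) (x ++ a :: (z ++ [X]))

theorem Hit.sw {x X} (h : Hit x X) : Hit (sw x) X.swap :=
  ⟨safe_sw.2 h.safe, by simpa using h.hit.symm⟩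

theorem Step.sw {w w' : List Letter} (h : Step w w') : Step (sw w) (sw w') := by
  cases h with
  | bar x => simpa using Step.bar (VWord.sw x)
  | hit h => simpa using Step.hit h.sw

theorem Step.length {w w' : List Letter} (h : Step w w') : w'.length = w.length := by
  cases h <;> simp ; omega

theorem append_cons_split {α : Type*} {x p q z : List α} {X : α} (h : x ++ X :: z = p ++ q) :
    (∃ m, p = x ++ X :: m ∧ z = m ++ q) ∨ (∃ m, x = p ++ m ∧ q = m ++ X :: z) := by
  rcases List.append_eq_append_iff.1 h with ⟨m, h1, h2⟩ | ⟨m, h1, h2⟩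
  · cases m with
    | nil => right; exact ⟨[], by simpa using h1.symm, by simpa using h2.symm⟩
    | cons y m =>
      simp only [List.cons_append, List.cons.injEq] at h2
      left; exact ⟨m, by rw [h1, h2.1], h2.2⟩
  · right; exact ⟨m, h1, h2⟩

/-- Promotion steps are deterministic. -/
theorem Step.unique {w w₁ w₂ : List Letter} (h₁ : Step w w₁) (h₂ : Step w w₂) : w₁ = w₂ := by
  cases h₁ with
  | bar x => cases h₂; rfl
  | @hit x X z h =>
    generalize e : a :: (x ++ X :: z) = w at h₂
    cases h₂ with
    | bar x => simp at e
    | @hit y Y t h' =>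
      simp only [List.cons.injEq, true_and] at e
      rcases append_cons_split e with ⟨m, rfl, rfl⟩ | ⟨m, rfl, e2⟩
      · exfalso
        have := h'.safe
        have h3 := h.hit
        simp only [safe_append, safe_cons] at this
        have := this.2.2.2.start
        omega
      · cases m with
        | nil =>
          simp only [List.nil_append, List.cons.injEq] at e2
          obtain ⟨rfl, rfl⟩ := e2
          simp
        | cons y m =>
          exfalso
          simp only [List.cons_append, List.cons.injEq] at e2
          obtain ⟨rfl, rfl⟩ := e2
          have := h.safe
          have h3 := h'.hit
          simp only [safe_append, safe_cons] at this
          have := this.2.2.2.start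
          omega

/-- `n` steps of promotion. -/
def Steps : ℕ → List Letter → List Letter → Prop
  | 0, w, w' => w = w'
  | n + 1, w, w' => ∃ m, Step w m ∧ Steps n m w'

theorem Steps.trans {n k : ℕ} {w w' w'' : List Letter} (h : Steps n w w') (h' : Steps k w' w'') :
    Steps (n + k) w w'' := by
  induction n generalizing w with
  | zero => cases h; simpa using h'
  | succ n ih =>
    obtain ⟨m, h1, h2⟩ := h
    rw [Nat.succ_add]
    exact ⟨m, h1, ih h2⟩

theorem Steps.split {n k : ℕ} {w w'' : List Letter} (h : Steps (n + k) w w'') :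
    ∃ w', Steps n w w' ∧ Steps k w' w'' := by
  induction n generalizing w with
  | zero => exact ⟨w, rfl, by simpa using h⟩
  | succ n ih =>
    rw [Nat.succ_add] at h
    obtain ⟨m, h1, h2⟩ := h
    obtain ⟨w', h3, h4⟩ := ih h2
    exact ⟨w', ⟨m, h1, h3⟩, h4⟩

theorem Steps.sw {n : ℕ} {w w' : List Letter} (h : Steps n w w') :
    Steps n (VWord.sw w) (VWord.sw w') := by
  induction n generalizing w with
  | zero => cases h; rfl
  | succ n ih => obtain ⟨m, h1, h2⟩ := h; exact ⟨_, h1.sw, ih h2⟩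

theorem Steps.length {n : ℕ} {w w' : List Letter} (h : Steps n w w') : w'.length = w.length := by
  induction n generalizing w with
  | zero => cases h; rfl
  | succ n ih => obtain ⟨m, h1, h2⟩ := h; rw [ih h2, h1.length]

/-! ### Good words are closed under promotion steps -/

/-- If the last unmatched `a` before a hit letter stays visible from later on, it comes later. -/
theorem LateC.of_hit {x m : List Letter} {X : Letter} (hx : Hit x X)
    (hB1 : 1 ≤ hB (a :: (x ++ X :: m))) (hC1 : 1 ≤ hC (a :: (x ++ X :: m)))
    (h : LateC (a :: (x ++ X :: m))) : LateC m := by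
  obtain ⟨t, ⟨p, hp⟩, h2, h3⟩ := h
  have hm : m <:+ a :: (x ++ X :: m) := ⟨a :: (x ++ [X]), by simp⟩
  have hhit := hx.hit
  simp only [hB_cons, hC_cons, hB_append, hC_append, u_a, v_a] at hB1 hC1
  rcases List.suffix_or_suffix_of_suffix ⟨p, hp⟩ hm with ht | ht
  · exact ⟨t, ht, h2, h3⟩
  · refine ⟨m, List.suffix_rfl, ?_, fun t' h' => h3 t' (h'.trans ht)⟩
    have h4 := h3 m ht
    have hCm : hC m = 1 + (hC x + (X.v + hC m)) := by omega
    cases p with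
    | nil =>
      simp only [List.nil_append] at hp
      have h5 := h3 t List.suffix_rfl
      rw [hp] at h5
      simp at h5; omega
    | cons y p =>
      simp only [List.cons_append, List.cons.injEq] at hp
      obtain ⟨rfl, hp⟩ := hp
      have e : hC p + hC t = hC x + (X.v + hC m) := by
        rw [← hC_append, hp]; simp
      rcases append_cons_split hp.symm with ⟨n, rfl, e'⟩ | ⟨n, rfl, e'⟩
      · obtain ⟨r, rfl⟩ := ht
        have hl := congrArg List.length e'
        simp at hl
        have : n = [] ∧ r = [] :=
          ⟨List.length_eq_zero_iff.1 (by omega), List.length_eq_zero_iff.1 (by omega)⟩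
        rw [this.2] at h2
        simpa using h2
      · have h6 := hx.safe
        simp only [safe_append] at h6
        have := h6.1.last
        omega

theorem LateB.of_hit {x m : List Letter} {X : Letter} (hx : Hit x X)
    (hB1 : 1 ≤ hB (a :: (x ++ X :: m))) (hC1 : 1 ≤ hC (a :: (x ++ X :: m)))
    (h : LateB (a :: (x ++ X :: m))) : LateB m := by
  rw [← lateC_sw] at h ⊢
  refine LateC.of_hit hx.sw ?_ ?_ (by simpa using h)
  · simpa using hC1
  · simpa using hB1

/-- The witness cannot be all of `a :: x`, where `hB` is positive, so it is a suffix of `x`, and the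
rest of `x` contributes a nonnegative amount to `hC`. It follows that a `c` right after `x` is not
hit. -/
theorem LateC.two_le {x : List Letter} (hx : Safe 0 0 x) (hB1 : 1 ≤ hB (a :: x))
    (h : LateC (a :: x)) : 1 ≤ hC x ∧ LateC x := by
  obtain ⟨t, ⟨p, hp⟩, h2, h3⟩ := h
  cases p with
  | nil =>
    have := h3 t List.suffix_rfl
    simp only [List.nil_append] at hp
    rw [hp] at this; omega
  | cons y p =>
    simp only [List.cons_append, List.cons.injEq] at hp
    obtain ⟨rfl, rfl⟩ := hp
    simp only [safe_append] at hx
    have := hx.1.last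
    exact ⟨by simp; omega, t, List.suffix_append _ _, h2, h3⟩

theorem LateB.two_le {x : List Letter} (hx : Safe 0 0 x) (hC1 : 1 ≤ hC (a :: x))
    (h : LateB (a :: x)) : 1 ≤ hB x ∧ LateB x := by
  rw [← lateC_sw] at h ⊢
  simpa using LateC.two_le (safe_sw.2 hx) (by simpa using hC1) (by simpa using h)

theorem Safe.suffix {i j : ℤ} {w s : List Letter} (h : Safe i j w) (hs : s <:+ w) :
    hB s ≤ i + hB w ∧ hC s ≤ j + hC w := by
  obtain ⟨p, rfl⟩ := hs
  have := (safe_append.1 h).1.last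
  simp; omega

theorem Hit.nonpos {x X} (h : Hit x X) : X = b ∨ X = c ∨ X = d := by
  have := h.safe.last
  have := h.hit
  cases X <;> simp at * <;> omega

theorem Step.inv {y r w'} (h : Step (y :: r) w') : (y = Letter.bar ∧ w' = r ++ [Letter.bar]) ∨
    (y = a ∧ ∃ x X z, r = x ++ X :: z ∧ Hit x X ∧ w' = x ++ a :: (z ++ [X])) := by
  cases h with
  | bar => exact Or.inl ⟨rfl, rfl⟩
  | @hit x X z h => exact Or.inr ⟨rfl, x, X, z, rfl, h, rfl⟩

/-- A witness that reaches beyond `m` forces `hC m ≤ 0`, so the hit at `X` is not for `c`. It is for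
`b`, and then `hB m` is the height of the whole prefix, which is positive: `m` is itself a witness.
-/
theorem LateB.of_replace {x m : List Letter} {X : Letter} (hx : Hit x X)
    (hB1 : 1 ≤ hB (a :: (x ++ X :: m))) (hC1 : 1 ≤ hC (a :: (x ++ X :: m)))
    (h : LateB (x ++ a :: m)) : LateB m := by
  obtain ⟨t, ht, h2, h3⟩ := h
  have hhit := hx.hit
  simp only [hB_cons, hC_cons, hB_append, hC_append, u_a, v_a] at hB1 hC1
  rcases List.suffix_or_suffix_of_suffix ht (show m <:+ x ++ a :: m from ⟨x ++ [a], by simp⟩) with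
    h | h
  · exact ⟨t, h, h2, h3⟩
  · have := h3 m h
    exact ⟨m, List.suffix_rfl, by omega, fun t' h' => h3 t' (h'.trans h)⟩

theorem LateC.of_replace {x m : List Letter} {X : Letter} (hx : Hit x X)
    (hB1 : 1 ≤ hB (a :: (x ++ X :: m))) (hC1 : 1 ≤ hC (a :: (x ++ X :: m)))
    (h : LateC (x ++ a :: m)) : LateC m := by
  rw [← lateB_sw] at h ⊢
  exact LateB.of_replace hx.sw (by simpa using hC1) (by simpa using hB1) (by simpa using h)

/-- A hit letter `d` lowers both heights to `0`. -/
theorem Good.hit_d {x z : List Letter} (hG : Good (a :: (x ++ d :: z))) (h : Hit x d) :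
    hB x = 0 ∧ hC x = 0 := by
  have hm := hG.merged (a :: x) z (by simp)
  have h1 := h.safe.last
  have h2 := h.hit
  simp at h1 h2
  have aux (t) (ht : t <:+ x) := h.safe.suffix ht
  have hsuf : x <:+ a :: x := List.suffix_cons _ _
  by_contra hcon
  rcases h2 with h2 | h2
  -- If only one height vanished, `x` would show that the last unmatched `a` is unmatched for the
  -- other letter alone: `x` starts safely at `0` and ends at height `0` for the first letter, so
  -- its suffixes have nonpositive height there.
  · refine hm.2 ⟨x, hsuf, by omega, fun t ht => ?_⟩
    have := aux t ht; omega
  · refine hm.1 ⟨x, hsuf, by omega, fun t ht => ?_⟩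
    have := aux t ht; omega

/-- The delicate point is the condition on letters `d`. For a `d` beyond the hit position, lateness
after the step already comes from the part behind the hit letter, so it was present before. If `d`
is the hit letter, both heights vanish there, and the `a` put in its place is unmatched for `b` and
`c` alike. -/
theorem Good.step {w w' : List Letter} (hG : Good w) (h : Step w w') : Good w' := by
  cases h with
  | bar x =>
    have hs := hG.safe
    have hb := hG.hB_eq
    have hc := hG.hC_eq
    simp at hs hb hc
    refine ⟨by simp [hs, hb, hc], by simp [hb], by simp [hc], fun p s e => ?_⟩
    rcases append_cons_split e.symm with ⟨m, rfl, rfl⟩ | ⟨m, rfl, e2⟩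
    · have := hG.merged (Letter.bar :: p) m (by simp)
      exact ⟨fun h => this.1 (h.mono (List.suffix_cons _ _)),
        fun h => this.2 (h.mono (List.suffix_cons _ _))⟩
    · cases m <;> simp at e2
  | @hit x X z h =>
    have hs := hG.safe
    have hb := hG.hB_eq
    have hc := hG.hC_eq
    have hX : X.u ≤ 0 ∧ X.v ≤ 0 := by rcases h.nonpos with rfl | rfl | rfl <;> simp
    simp only [safe_cons, safe_append, hB_cons, hC_cons, hB_append, hC_append, u_a, v_a] at hs hb hc
    have hx := h.safe
    have hxl := hx.last
    have hz : Safe (hB x + 1) (hC x + 1) z := hs.2.2.2.2.2.mono (by omega) (by omega)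
    have hzl := hz.last
    refine ⟨?_, by simp; omega, by simp; omega, fun p s e => ?_⟩
    · simp only [safe_append, safe_cons, safe_nil, u_a, v_a, zero_add]
      refine ⟨hx, by omega, by omega, hz, by omega, by omega, by omega, by omega⟩
    · rcases append_cons_split e.symm with ⟨m, rfl, rfl⟩ | ⟨m, rfl, e2⟩
      · have := hG.merged (a :: p) (m ++ X :: z) (by simp)
        exact ⟨fun h => this.1 (h.mono (List.suffix_cons _ _)),
          fun h => this.2 (h.mono (List.suffix_cons _ _))⟩
      cases m with
      | nil => simp at e2
      | cons y m =>
        simp only [List.cons_append, List.cons.injEq] at e2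
        obtain ⟨rfl, e2⟩ := e2
        rcases append_cons_split e2.symm with ⟨n, rfl, rfl⟩ | ⟨n, rfl, e3⟩
        · have hm := hG.merged (a :: (x ++ X :: m)) n (by simp)
          have hsm := hs.2.2.2.2.2
          simp only [safe_append, safe_cons, u_d, v_d] at hsm
          have h4 := hsm.2.2.2.start
          have hB1 : 1 ≤ hB (a :: (x ++ X :: m)) := by simp; omega
          have hC1 : 1 ≤ hC (a :: (x ++ X :: m)) := by simp; omega
          have hsuf : m <:+ a :: (x ++ X :: m) := ⟨a :: (x ++ [X]), by simp⟩
          exact ⟨fun h' => hm.1 ((LateB.of_replace h hB1 hC1 h').mono hsuf),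
            fun h' => hm.2 ((LateC.of_replace h hB1 hC1 h').mono hsuf)⟩
        · cases n with
          | cons y n => simp at e3
          | nil =>
            simp only [List.nil_append, List.cons.injEq] at e3
            obtain ⟨rfl, rfl⟩ := e3
            have h0 := hG.hit_d h
            -- Both heights of `a :: z` are `1`, so neither kind of late witness can contain it;
            -- shorter suffixes have no positive height at all.
            have aux : ∀ t, t <:+ x ++ a :: z → (hB t ≤ 0 ∧ hC t ≤ 0) ∨ a :: z <:+ t := by
              intro t ht
              rcases List.suffix_or_suffix_of_suffix ht (List.suffix_append x (a :: z)) with h' | h'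
              · rcases List.suffix_cons_iff.1 h' with rfl | h'
                · exact Or.inr List.suffix_rfl
                · left
                  have := hz.suffix h'
                  simp at hb hc
                  obtain ⟨r, rfl⟩ := h'
                  have h5 := hs.2.2.2.2.2
                  simp only [safe_append] at h5
                  have h5 := h5.1.last
                  simp at h5 hb hc
                  omega
              · exact Or.inr h'
            simp only [List.append_nil]
            simp at hb hc
            constructor
            · rintro ⟨t, h1, h2, h3⟩
              rcases aux t h1 with h4 | h4
              · omega
              · have := h3 _ h4
                simp at this; omega
            · rintro ⟨t, h1, h2, h3⟩
              rcases aux t h1 with h4 | h4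
              · omega
              · have := h3 _ h4
                simp at this; omega

theorem Good.steps {n : ℕ} {w w' : List Letter} (hG : Good w) (h : Steps n w w') : Good w' := by
  induction n generalizing w with
  | zero => cases h; exact hG
  | succ n ih => obtain ⟨m, h1, h2⟩ := h; exact ih (hG.step h1) h2

/-! ### Uncrossing two adjacent strands -/

/-- The height over `c` is restarted at an arbitrary level `k`, while the height over `b` stays
safe. This locates the letter that closes a given strand. -/
theorem exists_first_fall_C {y : List Letter} : ∀ {i j k : ℤ}, Safe i j y → 0 ≤ k →
    k + hC y ≤ -1 → ∃ y₁ Y y₂, y = y₁ ++ Y :: y₂ ∧ Safe i k y₁ ∧ k + hC y₁ = 0 ∧ Y.v = -1 := by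
  induction y with
  | nil => intro i j k _ h1 h2; simp at h2; omega
  | cons Y y ih =>
    intro i j k h h1 h2
    have hY : -1 ≤ Y.v := by cases Y <;> simp
    by_cases hk : k + Y.v < 0
    · exact ⟨[], Y, y, rfl, ⟨h.start.1, h1⟩, by simp; omega, by omega⟩
    · obtain ⟨y₁, Z, y₂, rfl, h3, h4, h5⟩ := ih h.2.2 (by omega : 0 ≤ k + Y.v)
        (by simp at h2; omega)
      exact ⟨Y :: y₁, Z, y₂, rfl, ⟨h.start.1, h1, h3⟩, by simp; omega, h5⟩

theorem exists_first_fall_B {y : List Letter} {i j k : ℤ} (h : Safe i j y) (hk : 0 ≤ k)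
    (hy : k + hB y ≤ -1) :
    ∃ y₁ Y y₂, y = y₁ ++ Y :: y₂ ∧ Safe k j y₁ ∧ k + hB y₁ = 0 ∧ Y.u = -1 := by
  obtain ⟨y₁, Y, y₂, h1, h2, h3, h4⟩ :=
    exists_first_fall_C (y := sw y) (safe_sw.2 h) hk (by simpa using hy)
  exact ⟨sw y₁, Y.swap, sw y₂, by rw [← sw_sw y, h1]; simp, safe_sw.2 h2, by simpa using h3,
    by simpa using h4⟩

/-- The second word differs from the first by crossing the two strands that end at a given pair of
adjacent positions; `x` is what precedes that pair. -/
inductive Uncross (x : List Letter) : List Letter → List Letter → Prop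
  | cross {y} (h : LateC x) : Uncross x (x ++ c :: b :: y) (x ++ b :: c :: y)
  | mid {y₁ y₂} (h : Safe 0 0 y₁) (h' : hC y₁ = 0) :
      Uncross x (x ++ c :: a :: (y₁ ++ c :: y₂)) (x ++ a :: c :: (y₁ ++ c :: y₂))
  | far {y₁ z₁ z₂} (h : Safe 0 0 y₁) (h' : hC y₁ = 0) (hz : Safe (hB y₁ + 1) 0 z₁)
      (hz' : hB y₁ + hB z₁ = -1) :
      Uncross x (x ++ a :: a :: (y₁ ++ c :: (z₁ ++ b :: z₂)))
        (x ++ a :: c :: (y₁ ++ a :: (z₁ ++ b :: z₂)))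

/-- By lateness `hC x` is positive once the leading `a` gets through `x`, so it passes the `c`. It
can stop at the `b`, in both words; then the `b` becomes an `a` and the pattern turns into `mid`. A
hit before or after the pair leaves it a crossing. -/
theorem Uncross.step_cross {x y w' : List Letter} (hG : Good (a :: x ++ c :: b :: y))
    (hx : LateC (a :: x)) (hs : Step (a :: x ++ c :: b :: y) w') :
    ∃ x' w'', x'.length = x.length ∧ Step (a :: x ++ b :: c :: y) w'' ∧ Uncross x' w' w'' := by
  obtain ⟨⟨⟩, -⟩ | ⟨-, x₁, X, z, e, hh, rfl⟩ := Step.inv hs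
  have hS := hG.safe
  have hb := hG.hB_eq
  have hc := hG.hC_eq
  simp at hS hb hc
  have hxl := hS.2.2.2.2.2.start
  have hB1 : 1 ≤ hB (a :: x) := by simp; omega
  have hC1 : 1 ≤ hC (a :: x) := by simp; omega
  rcases append_cons_split e.symm with ⟨m, rfl, rfl⟩ | ⟨m, rfl, e2⟩
  · refine ⟨x₁ ++ a :: m, x₁ ++ a :: m ++ b :: c :: (y ++ [X]), by simp, ?_, ?_⟩
    · simpa using Step.hit (z := m ++ b :: c :: y) hh
    · have : LateC (x₁ ++ a :: m) :=
        (LateC.of_hit hh hB1 hC1 hx).mono ⟨x₁ ++ [a], by simp⟩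
      simpa using Uncross.cross (y := y ++ [X]) this
  · have hsx : Safe 0 0 x := (safe_append.1 hh.safe).1
    obtain ⟨h2, hlate⟩ := LateC.two_le hsx hB1 hx
    have hhit := hh.hit
    rcases m with _ | ⟨_, _ | ⟨_, m⟩⟩
    · simp only [List.nil_append, List.cons.injEq] at e2
      obtain ⟨rfl, rfl⟩ := e2
      simp at hhit; have := hsx.last; omega
    · simp only [List.nil_append, List.cons_append, List.cons.injEq] at e2
      obtain ⟨rfl, rfl, rfl⟩ := e2
      simp at hhit
      have h0 : hB x = 0 := by omega
      have hy := hS.2.2.2.2.2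
      -- `Y` closes the strand for `c` of the new `a`. It is not a `d`: as `hB` is `0` right after
      -- the pair, safety at a `d` would need `1 ≤ hB y₁`, which makes the prefix before that `d`
      -- late for `b`.
      obtain ⟨y₁, Y, y₂, rfl, h4, h5, h6⟩ := exists_first_fall_C hy le_rfl (by omega)
      have hY : Y = c := by
        cases Y <;> simp at h6
        · rfl
        · exfalso
          have hm := (hG.merged (a :: x ++ c :: b :: y₁) y₂ (by simp)).1
          simp only [safe_append, safe_cons, u_d, v_d] at hy
          have h7 := hy.2.2.2.start
          refine hm ⟨y₁, ⟨a :: x ++ [c, b], by simp⟩, by omega, fun t ht => ?_⟩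
          have := h4.suffix ht
          omega
      subst hY
      refine ⟨x, x ++ a :: (c :: (y₁ ++ c :: y₂) ++ [b]), rfl, Step.hit ⟨hsx, by simp; omega⟩, ?_⟩
      simpa using Uncross.mid (x := x) (y₂ := y₂ ++ [b]) (h4.mono (by omega) le_rfl) (by omega)
    · simp only [List.cons_append, List.cons.injEq] at e2
      obtain ⟨rfl, rfl, rfl⟩ := e2
      have hsm := hh.safe
      simp at hsm
      refine ⟨x, x ++ b :: c :: m ++ a :: (z ++ [X]), rfl, ?_, ?_⟩
      · have : Hit (x ++ b :: c :: m) X := by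
          refine ⟨?_, by simp at hhit ⊢; omega⟩
          have := hsm.2.2.2.2.2.start
          simp
          refine ⟨hsx, by omega, by omega, by omega, by omega, by simpa using hsm.2.2.2.2.2⟩
        simpa using Step.hit (z := z) this
      · simpa using Uncross.cross (x := x) (y := m ++ a :: (z ++ [X])) hlate

/-- If the leading `a` stops at the first `c` of the pattern in one word, then in the other, where
an `a` precedes that `c`, it passes on to the `c` after `y₁`. Both words append a `c`, and the
pattern becomes `far`. Any other possible hit is at the same letter in both words and outside the
pattern. -/
theorem Uncross.step_mid {x y₁ y₂ w' : List Letter}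
    (hG : Good (a :: x ++ c :: a :: (y₁ ++ c :: y₂)))
    (hy : Safe 0 0 y₁) (hy0 : hC y₁ = 0)
    (hs : Step (a :: x ++ c :: a :: (y₁ ++ c :: y₂)) w') :
    ∃ x' w'', x'.length = x.length ∧ Step (a :: x ++ a :: c :: (y₁ ++ c :: y₂)) w'' ∧
      Uncross x' w' w'' := by
  obtain ⟨⟨⟩, -⟩ | ⟨-, x₁, X, z, e, hh, rfl⟩ := Step.inv hs
  have hS := hG.safe
  have hb := hG.hB_eq
  have hc := hG.hC_eq
  simp at hS hb hc
  rcases append_cons_split e.symm with ⟨m, rfl, rfl⟩ | ⟨m, rfl, e2⟩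
  · refine ⟨x₁ ++ a :: m, x₁ ++ a :: m ++ a :: c :: (y₁ ++ c :: (y₂ ++ [X])), by simp, ?_, ?_⟩
    · simpa using Step.hit (z := m ++ a :: c :: (y₁ ++ c :: y₂)) hh
    · simpa using Uncross.mid (x := x₁ ++ a :: m) (y₂ := y₂ ++ [X]) hy hy0
  · have hsx : Safe 0 0 x := (safe_append.1 hh.safe).1
    have hxl := hsx.last
    have hyl := hy.last
    have hhit := hh.hit
    rcases m with _ | ⟨_, _ | ⟨_, m⟩⟩
    · simp only [List.nil_append, List.cons.injEq] at e2
      obtain ⟨rfl, rfl⟩ := e2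
      simp at hhit
      have h0 : hC x = 0 := by omega
      have hy2 := hS.2.2.2.2.2.2.2.2
      -- The starting level is the height over `b` of `a y₁ c`; the letter found closes the strand
      -- for `b` of the `a` in the pattern.
      obtain ⟨z₁, Y, z₂, rfl, h4, h5, h6⟩ :=
        exists_first_fall_B (k := hB y₁ + 1) hy2 (by omega) (by omega)
      have h4 : Safe (hB y₁ + 1) 0 z₁ := h4.mono le_rfl (by omega)
      have hY : Y = b := by
        cases Y <;> simp at h6
        · rfl
        · exfalso
          have hm := (hG.merged (a :: x ++ c :: a :: (y₁ ++ c :: z₁)) z₂ (by simp)).2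
          simp only [safe_append, safe_cons, u_d, v_d] at hy2
          have h7 := hy2.2.2.2.start
          refine hm ⟨z₁, ⟨a :: x ++ c :: a :: (y₁ ++ [c]), by simp⟩, by omega, fun t ht => ?_⟩
          have := h4.suffix ht
          omega
      subst hY
      refine ⟨x, x ++ a :: c :: y₁ ++ a :: ((z₁ ++ b :: z₂) ++ [c]), rfl, ?_, ?_⟩
      · have : Hit (x ++ a :: c :: y₁) c := by
          refine ⟨?_, by simp; omega⟩
          simp
          refine ⟨hsx, by omega, by omega, by omega, by omega, hy.mono (by omega) (by omega)⟩
        simpa using Step.hit (z := z₁ ++ b :: z₂) this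
      · simpa using Uncross.far (x := x) (z₂ := z₂ ++ [c]) hy hy0 h4 (by omega)
    · simp only [List.nil_append, List.cons_append, List.cons.injEq] at e2
      obtain ⟨rfl, rfl, rfl⟩ := e2
      have := hh.nonpos
      simp at this
    · simp only [List.cons_append, List.cons.injEq] at e2
      obtain ⟨rfl, rfl, e2⟩ := e2
      have hsm := hh.safe
      simp at hsm hhit
      have h3 := hsm.2.2.2.2.1
      rcases append_cons_split e2.symm with ⟨n, rfl, rfl⟩ | ⟨n, rfl, e3⟩
      · simp at hy
        have := hy.2.2.2.start
        omega
      · rcases n with _ | ⟨_, n⟩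
        · simp only [List.nil_append, List.cons.injEq] at e3
          obtain ⟨rfl, rfl⟩ := e3
          simp at hhit
          omega
        · simp only [List.cons_append, List.cons.injEq] at e3
          obtain ⟨rfl, rfl⟩ := e3
          simp at hsm hhit
          refine ⟨x, x ++ a :: c :: (y₁ ++ c :: n) ++ a :: (z ++ [X]), rfl, ?_, ?_⟩
          · have : Hit (x ++ a :: c :: (y₁ ++ c :: n)) X := by
              refine ⟨?_, by simp; omega⟩
              have h8 := hsm.2.2.2.2.2.2.2
              simp
              refine ⟨hsx, by omega, by omega, by omega, by omega,
                hy.mono (by omega) (by omega), by omega, by omega, h8.2.mono (by omega) (by omega)⟩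
            simpa using Step.hit (z := z) this
          · simpa using Uncross.mid (x := x) (y₂ := n ++ a :: (z ++ [X])) hy hy0

/-- No hit falls inside the pattern: up to the closing `b`, the letters `a a` outweigh all the
descents. After that `b` the heights agree in the two words, so they are hit at the same letter. -/
theorem Uncross.step_far {x y₁ z₁ z₂ w' : List Letter}
    (hy : Safe 0 0 y₁) (hy0 : hC y₁ = 0) (hz : Safe (hB y₁ + 1) 0 z₁) (hz0 : hB y₁ + hB z₁ = -1)
    (hs : Step (a :: x ++ a :: a :: (y₁ ++ c :: (z₁ ++ b :: z₂))) w') :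
    ∃ x' w'', x'.length = x.length ∧
      Step (a :: x ++ a :: c :: (y₁ ++ a :: (z₁ ++ b :: z₂))) w'' ∧ Uncross x' w' w'' := by
  obtain ⟨⟨⟩, -⟩ | ⟨-, x₁, X, z, e, hh, rfl⟩ := Step.inv hs
  have hyl := hy.last
  have hzl := hz.last
  rcases append_cons_split e.symm with ⟨m, rfl, rfl⟩ | ⟨m, rfl, e2⟩
  · refine ⟨x₁ ++ a :: m, x₁ ++ a :: m ++ a :: c :: (y₁ ++ a :: (z₁ ++ b :: (z₂ ++ [X]))),
      by simp, ?_, ?_⟩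
    · simpa using Step.hit (z := m ++ a :: c :: (y₁ ++ a :: (z₁ ++ b :: z₂))) hh
    · simpa using Uncross.far (x := x₁ ++ a :: m) (z₂ := z₂ ++ [X]) hy hy0 hz hz0
  · have hsx : Safe 0 0 x := (safe_append.1 hh.safe).1
    have hxl := hsx.last
    have hhit := hh.hit
    have hnp := hh.nonpos
    rcases m with _ | ⟨_, _ | ⟨_, m⟩⟩
    · simp only [List.nil_append, List.cons.injEq] at e2
      obtain ⟨rfl, rfl⟩ := e2
      simp at hnp
    · simp only [List.nil_append, List.cons_append, List.cons.injEq] at e2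
      obtain ⟨rfl, rfl, rfl⟩ := e2
      simp at hnp
    · simp only [List.cons_append, List.cons.injEq] at e2
      obtain ⟨rfl, rfl, e2⟩ := e2
      have hsm := hh.safe
      simp at hsm hhit
      rcases append_cons_split e2.symm with ⟨n, rfl, rfl⟩ | ⟨n, rfl, e3⟩
      · simp at hy
        have := hy.2.2.2.start
        omega
      rcases n with _ | ⟨_, n⟩
      · simp only [List.nil_append, List.cons.injEq] at e3
        obtain ⟨rfl, rfl⟩ := e3
        simp at hhit
        omega
      simp only [List.cons_append, List.cons.injEq] at e3
      obtain ⟨rfl, e3⟩ := e3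
      simp at hsm hhit
      rcases append_cons_split e3.symm with ⟨k, rfl, rfl⟩ | ⟨k, rfl, e4⟩
      · simp at hz
        have := hz.2.2.2.start
        omega
      rcases k with _ | ⟨_, k⟩
      · simp only [List.nil_append, List.cons.injEq] at e4
        obtain ⟨rfl, rfl⟩ := e4
        simp at hhit
        omega
      simp only [List.cons_append, List.cons.injEq] at e4
      obtain ⟨rfl, rfl⟩ := e4
      simp at hsm hhit
      refine ⟨x, x ++ a :: c :: (y₁ ++ a :: (z₁ ++ b :: k)) ++ a :: (z ++ [X]), rfl, ?_, ?_⟩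
      · have : Hit (x ++ a :: c :: (y₁ ++ a :: (z₁ ++ b :: k))) X := by
          refine ⟨?_, by simp; omega⟩
          have h8 := hsm.2.2.2.2.2.2.2.2.2.2.2
          simp
          refine ⟨hsx, by omega, by omega, by omega, by omega,
            hy.mono (by omega) (by omega), by omega, by omega, hz.mono (by omega) (by omega),
            by omega, by omega, h8.mono (by omega) (by omega)⟩
        simpa using Step.hit (z := z) this
      · simpa using Uncross.far (x := x) (z₂ := k ++ a :: (z ++ [X])) hy hy0 hz hz0

theorem Uncross.step {x w₀ w w₀' : List Letter} (hG : Good w₀) (h : Uncross x w₀ w)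
    (hx : x ≠ []) (hs : Step w₀ w₀') :
    ∃ x' w', x'.length + 1 = x.length ∧ Step w w' ∧ Uncross x' w₀' w' := by
  obtain ⟨l, x, rfl⟩ := List.exists_cons_of_ne_nil hx
  have key : l = Letter.bar ∨ l = a := by
    cases h <;> (rcases Step.inv hs with h | h <;> simp [h.1])
  rcases key with rfl | rfl
  · cases h with
    | @cross y h =>
      obtain ⟨-, rfl⟩ | ⟨⟨⟩, -⟩ := Step.inv hs
      refine ⟨x, _, by simp, Step.bar _, ?_⟩
      simpa using Uncross.cross (y := y ++ [Letter.bar]) h.of_bar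
    | @mid y₁ y₂ h h' =>
      obtain ⟨-, rfl⟩ | ⟨⟨⟩, -⟩ := Step.inv hs
      refine ⟨x, _, by simp, Step.bar _, ?_⟩
      simpa using Uncross.mid (x := x) (y₂ := y₂ ++ [Letter.bar]) h h'
    | @far y₁ z₁ z₂ h h' hz hz' =>
      obtain ⟨-, rfl⟩ | ⟨⟨⟩, -⟩ := Step.inv hs
      refine ⟨x, _, by simp, Step.bar _, ?_⟩
      simpa using Uncross.far (x := x) (z₂ := z₂ ++ [Letter.bar]) h h' hz hz'
  · cases h with
    | cross h =>
      obtain ⟨x', w', h1, h2⟩ := Uncross.step_cross hG h hs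
      exact ⟨x', w', by simp [h1], h2⟩
    | mid h h' =>
      obtain ⟨x', w', h1, h2⟩ := Uncross.step_mid hG h h' hs
      exact ⟨x', w', by simp [h1], h2⟩
    | far h h' hz hz' =>
      obtain ⟨x', w', h1, h2⟩ := Uncross.step_far h h' hz hz' hs
      exact ⟨x', w', by simp [h1], h2⟩

theorem Uncross.steps {n : ℕ} {x w₀ w w₀' : List Letter} (hG : Good w₀) (h : Uncross x w₀ w)
    (hn : n ≤ x.length) (hs : Steps n w₀ w₀') :
    ∃ x' w', x'.length + n = x.length ∧ Steps n w w' ∧ Uncross x' w₀' w' := by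
  induction n generalizing x w₀ w with
  | zero => cases hs; exact ⟨x, w, rfl, rfl, h⟩
  | succ n ih =>
    obtain ⟨m, h1, h2⟩ := hs
    obtain ⟨x₁, w₁, h3, h4, h5⟩ := h.step hG (by rintro rfl; simp at hn) h1
    obtain ⟨x₂, w₂, h6, h7, h8⟩ := ih (hG.step h1) h5 (by omega) h2
    exact ⟨x₂, w₂, by omega, ⟨w₁, h4, h7⟩, h8⟩

/-- When the pair of strands comes first, two steps move it to the end and exchange the roles of
`b` and `c`. -/
theorem Uncross.turn {w₀ w w₀' : List Letter} (hG : Good w₀) (h : Uncross [] w₀ w)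
    (hs : Steps 2 w₀ w₀') :
    ∃ x' w', x'.length + 2 = w₀.length ∧ Steps 2 w w' ∧ Uncross x' (sw w₀') (sw w') := by
  cases h with
  | cross h =>
    obtain ⟨t, h1, h2, -⟩ := h
    rw [List.suffix_nil.1 h1] at h2
    simp at h2
  | mid h h' =>
    have := hG.safe
    simp at this
  | @far y₁ z₁ z₂ hy hy0 hz hz0 =>
    have hyl := hy.last
    have hS := hG.safe
    have hb := hG.hB_eq
    have hc := hG.hC_eq
    simp at hS hb hc
    -- In `w₀` the first `a` stops at the `b` and the second at the `c`; in `w` it is the other way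
    -- round. The words become equal except for the order of the two appended letters.
    have e₀ : w₀' = y₁ ++ a :: (z₁ ++ a :: z₂) ++ [b, c] := by
      obtain ⟨m, h1, m', h2, rfl⟩ := hs
      have h3 : Hit (a :: (y₁ ++ c :: z₁)) b := by
        refine ⟨?_, by simp; omega⟩
        simp
        exact ⟨hy.mono (by omega) (by omega), by omega, by omega, hz.mono (by omega) (by omega)⟩
      have h4 := Step.hit (z := z₂) h3
      simp only [List.cons_append, List.append_assoc] at h4
      obtain rfl := h1.unique h4
      have h5 : Hit y₁ c := ⟨hy, by simp; omega⟩
      have h6 := Step.hit (z := z₁ ++ a :: (z₂ ++ [b])) h5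
      obtain rfl := h2.unique h6
      simp
    subst e₀
    refine ⟨sw (y₁ ++ a :: (z₁ ++ a :: z₂)), y₁ ++ a :: (z₁ ++ a :: z₂) ++ [c, b],
      by simp, ?_, ?_⟩
    · have h3 : Hit [] c := ⟨by simp, by simp⟩
      refine ⟨_, Step.hit h3, _, ?_, rfl⟩
      have h5 : Hit (y₁ ++ a :: z₁) b := by
        refine ⟨?_, by simp; omega⟩
        simp
        exact ⟨hy, by omega, by omega, hz.mono (by omega) (by omega)⟩
      simpa using Step.hit (z := z₂ ++ [c]) h5
    · have : LateB (y₁ ++ a :: (z₁ ++ a :: z₂)) := by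
        refine ⟨a :: z₂, ⟨y₁ ++ a :: z₁, by simp⟩, by simp; omega, fun t ht => ?_⟩
        have hzl := hz.last
        rcases List.suffix_cons_iff.1 ht with rfl | ht
        · simp; omega
        · have := hS.2.2.2.2.2.2.suffix ht
          omega
      simpa using Uncross.cross (y := []) (lateC_sw.2 this)

/-- The steps are counted as `x.length` to bring the pair to the front, `2` to turn it, and
`y.length` to bring it back to its place, mirrored. The first word then returns to itself up to
`sw`, which determines the second. -/
theorem steps_sw_of_cross {x y : List Letter} (hG : Good (x ++ c :: b :: y)) (hx : LateC x)
    (hs : Steps (x ++ c :: b :: y).length (x ++ c :: b :: y) (sw (x ++ c :: b :: y))) :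
    Steps (x ++ b :: c :: y).length (x ++ b :: c :: y) (sw (x ++ b :: c :: y)) := by
  have e : (x ++ c :: b :: y).length = x.length + (2 + y.length) := by simp; omega
  have e' : (x ++ b :: c :: y).length = x.length + (2 + y.length) := by simp; omega
  have hlen := e
  rw [e] at hs
  obtain ⟨w₁, s1, s2⟩ := hs.split
  obtain ⟨w₂, s2, s3⟩ := s2.split
  obtain ⟨x₁, v₁, h1, h2, h3⟩ := (Uncross.cross (y := y) hx).steps hG le_rfl s1
  obtain rfl := List.length_eq_zero_iff.1 (show x₁.length = 0 by omega)
  obtain ⟨x₂, v₂, h4, h5, h6⟩ := h3.turn (hG.steps s1) s2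
  rw [s1.length] at h4
  obtain ⟨x₃, v₃, h7, h8, h9⟩ := h6.steps (hG.steps s1 |>.steps s2 |>.sw) (by omega) s3.sw
  rw [sw_sw] at h9
  have hx3 : x₃.length = x.length := by omega
  -- The first word again has `c b` at this position; `mid` would need `c a` there and `far` would
  -- need `a a`.
  have key : v₃ = x ++ b :: c :: y := by
    generalize hw : x ++ c :: b :: y = w at h9
    cases h9 with
    | cross h =>
      obtain ⟨rfl, e3⟩ := List.append_inj hw hx3.symm
      simp at e3; rw [e3]
    | mid h h' =>
      obtain ⟨rfl, h⟩ := List.append_inj hw hx3.symm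
      simp at h
    | far h h' hz hz' =>
      obtain ⟨rfl, h⟩ := List.append_inj hw hx3.symm
      simp at h
  subst key
  rw [e']
  refine h2.trans (h5.trans ?_)
  simpa using h8.sw

/-! ### Closed pieces of a word -/

theorem suffix_append_cases {t p m : List Letter} (h : t <:+ p ++ m) :
    t <:+ m ∨ ∃ r, r <:+ p ∧ t = r ++ m := by
  rcases List.suffix_or_suffix_of_suffix h (List.suffix_append p m) with h' | ⟨r, rfl⟩
  · exact Or.inl h'
  · obtain ⟨q, hq⟩ := h
    rw [← List.append_assoc] at hq
    exact Or.inr ⟨r, ⟨q, List.append_cancel_right hq⟩, rfl⟩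

/-- A suffix that reaches beyond `g` keeps its heights, and one that ends inside `g` gains nothing
over `c`, because suffixes of `g` have nonpositive height. The contrapositive is used in
`Good.of_insert`. -/
theorem LateB.insert {x g m : List Letter} (h : LateB (x ++ m)) (hB0 : hB g = 0) (hC0 : hC g = 0)
    (hg : ∀ s, s <:+ g → hC s ≤ 0) : LateB (x ++ (g ++ m)) := by
  obtain ⟨t, h1, h2, h3⟩ := h
  rcases suffix_append_cases h1 with h4 | ⟨r, h4, rfl⟩
  · exact ⟨t, h4.trans ⟨x ++ g, by simp⟩, h2, h3⟩
  · obtain ⟨q, rfl⟩ := h4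
    refine ⟨r ++ (g ++ m), ⟨q, by simp⟩, by simp at h2 ⊢; omega, fun t' ht' => ?_⟩
    have hm := h3 m (List.suffix_append _ _)
    rcases suffix_append_cases ht' with h5 | ⟨r', h5, rfl⟩
    · rcases suffix_append_cases h5 with h6 | ⟨g', h6, rfl⟩
      · exact h3 t' (h6.trans (List.suffix_append _ _))
      · have := hg g' h6
        simp; omega
    · obtain ⟨r₀, rfl⟩ := h5
      have := h3 (r' ++ m) ⟨r₀, by simp⟩
      simp at this ⊢; omega

theorem LateC.insert {x g m : List Letter} (h : LateC (x ++ m)) (hB0 : hB g = 0) (hC0 : hC g = 0)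
    (hg : ∀ s, s <:+ g → hB s ≤ 0) : LateC (x ++ (g ++ m)) := by
  rw [← lateB_sw] at h ⊢
  have := LateB.insert (x := sw x) (g := sw g) (m := sw m) (by simpa using h) (by simpa using hC0)
    (by simpa using hB0) fun s hs => by
      simpa using hg (sw s) (by simpa using sw_suffix hs)
  simpa using this

/-- A closed piece of a word, which promotion moves as a whole. -/
structure Neutral (g : List Letter) : Prop where
  hB_eq : hB g = 0
  hC_eq : hC g = 0
  safe : Safe 0 0 g
  loop : ∀ y, Safe 0 0 y → hB y = 0 → hC y = 0 → Steps g.length (g ++ y) (y ++ sw g)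

theorem Neutral.sw {g : List Letter} (h : Neutral g) : Neutral (sw g) where
  hB_eq := by simpa using h.hC_eq
  hC_eq := by simpa using h.hB_eq
  safe := safe_sw.2 h.safe
  loop y hy hB0 hC0 := by
    have := (h.loop (VWord.sw y) (safe_sw.2 hy) (by simpa using hC0) (by simpa using hB0)).sw
    simpa using this

theorem Good.of_insert {x g y : List Letter} (hg : Neutral g) (h : Good (x ++ (g ++ y))) :
    Good (x ++ y) := by
  have hs := h.safe
  have hb := h.hB_eq
  have hc := h.hC_eq
  simp only [safe_append, hB_append, hC_append, hg.hB_eq, hg.hC_eq, add_zero, zero_add]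
    at hs hb hc
  refine ⟨by simpa using ⟨hs.1, hs.2.2⟩, by simpa, by simpa, fun p s e => ?_⟩
  rcases append_cons_split e.symm with ⟨m, rfl, rfl⟩ | ⟨m, rfl, rfl⟩
  · exact h.merged p (m ++ (g ++ y)) (by simp)
  · have hm := h.merged (x ++ (g ++ m)) s (by simp)
    have hsuf (s) (hs : s <:+ g) : hB s ≤ 0 ∧ hC s ≤ 0 := by
      have := hg.safe.suffix hs
      simpa [hg.hB_eq, hg.hC_eq] using this
    exact ⟨fun h' => hm.1 (h'.insert hg.hB_eq hg.hC_eq fun s hs => (hsuf s hs).2),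
      fun h' => hm.2 (h'.insert hg.hB_eq hg.hC_eq fun s hs => (hsuf s hs).1)⟩

theorem Step.insert {x g y w' : List Letter} (hg : Neutral g) (hx : x ≠ [])
    (h : Step (x ++ y) w') : ∃ x' y', w' = x' ++ y' ∧ x'.length + 1 = x.length ∧
      Step (x ++ (g ++ y)) (x' ++ (g ++ y')) := by
  obtain ⟨l, x, rfl⟩ := List.exists_cons_of_ne_nil hx
  rw [List.cons_append] at h
  obtain ⟨rfl, rfl⟩ | ⟨rfl, x₂, X, z, e, hh, rfl⟩ := Step.inv h
  · exact ⟨x, y ++ [Letter.bar], by simp, by simp, by simpa using Step.bar (x ++ (g ++ y))⟩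
  · rcases append_cons_split e.symm with ⟨m, rfl, rfl⟩ | ⟨m, rfl, rfl⟩
    · refine ⟨x₂ ++ a :: m, y ++ [X], by simp, by simp, ?_⟩
      simpa using Step.hit (z := m ++ (g ++ y)) hh
    · refine ⟨x, m ++ a :: (z ++ [X]), by simp, by simp, ?_⟩
      have hs := hh.safe
      have hh' : Hit (x ++ (g ++ m)) X := by
        refine ⟨?_, by simpa [hg.hB_eq, hg.hC_eq] using hh.hit⟩
        simp only [safe_append, hg.hB_eq, hg.hC_eq, add_zero] at hs ⊢
        have := hs.1.last
        exact ⟨hs.1, hg.safe.mono (by omega) (by omega), hs.2⟩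
      simpa using Step.hit (z := z) hh'

theorem Steps.insert {n : ℕ} {x g y w' : List Letter} (hg : Neutral g) (hn : n ≤ x.length)
    (h : Steps n (x ++ y) w') : ∃ x' y', w' = x' ++ y' ∧ x'.length + n = x.length ∧
      Steps n (x ++ (g ++ y)) (x' ++ (g ++ y')) := by
  induction n generalizing x y with
  | zero => cases h; exact ⟨x, y, rfl, rfl, rfl⟩
  | succ n ih =>
    obtain ⟨m, h1, h2⟩ := h
    obtain ⟨x₁, y₁, rfl, h3, h4⟩ := h1.insert hg (by rintro rfl; simp at hn)
    obtain ⟨x₂, y₂, rfl, h5, h6⟩ := ih (by omega) h2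
    exact ⟨x₂, y₂, rfl, by omega, _, h4, h6⟩

/-- As long as `g` is not in front, it changes no heights and contains no hit, so steps ignore it.
At the front it faces a balanced good word, and `Neutral.loop` carries it to the end as `sw g`; the
remaining steps ignore `sw g` in the same way. -/
theorem steps_sw_insert {x g y : List Letter} (hg : Neutral g) (hG : Good (x ++ y))
    (h : Steps (x ++ y).length (x ++ y) (sw (x ++ y))) :
    Steps (x ++ (g ++ y)).length (x ++ (g ++ y)) (sw (x ++ (g ++ y))) := by
  rw [List.length_append] at h
  obtain ⟨w₁, s1, s2⟩ := h.split
  obtain ⟨x₁, y₁, rfl, h1, h2⟩ := s1.insert hg le_rfl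
  obtain rfl := List.length_eq_zero_iff.1 (show x₁.length = 0 by omega)
  have hG1 := hG.steps s1
  have hl := s1.length
  rw [List.nil_append] at hG1 s2 h2 hl
  have h3 := hg.loop y₁ hG1.safe hG1.hB_eq hG1.hC_eq
  rw [List.length_append] at hl
  have s2 : Steps y.length (y₁ ++ []) (sw (x ++ y)) := by simpa using s2
  obtain ⟨x₂, y₂, e, h4, h5⟩ := s2.insert hg.sw (by omega)
  rw [sw_append] at e
  obtain ⟨rfl, rfl⟩ := List.append_inj e (by simp; omega)
  have := h2.trans (h3.trans (by simpa using h5))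
  simpa [Nat.add_assoc, Nat.add_comm, Nat.add_left_comm] using this

theorem neutral_bar : Neutral [Letter.bar] where
  hB_eq := rfl
  hC_eq := rfl
  safe := by simp
  loop y _ _ _ := ⟨_, Step.bar y, rfl⟩

theorem neutral_ad : Neutral [a, d] where
  hB_eq := rfl
  hC_eq := rfl
  safe := by simp
  loop y hy hB0 hC0 := by
    refine ⟨a :: (y ++ [d]), Step.hit (x := []) ⟨by simp, by simp⟩, _, ?_, rfl⟩
    exact Step.hit (z := []) ⟨hy, by simp [hB0]⟩

theorem neutral_abc : Neutral [a, b, c] where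
  hB_eq := rfl
  hC_eq := rfl
  safe := by simp
  loop y hy hB0 hC0 := by
    refine ⟨a :: (c :: y ++ [b]), Step.hit (x := []) ⟨by simp, by simp⟩,
      a :: (y ++ [b] ++ [c]), Step.hit (x := []) ⟨by simp, by simp⟩, _, ?_, rfl⟩
    simpa using Step.hit (z := [c]) (X := b) ⟨hy, by simp [hB0]⟩

/-! ### The exchange of `b` and `c` by induction on the length -/

/-- If the witness starts within the pair, it can be shortened to `s`, since neither letter raises
`hC`. If it contains the pair, the only new suffix to check is `X :: s`, where `X` does not raise
`hB`. -/
theorem LateC.exchange {p s : List Letter} {X Y : Letter} (hX : X.u ≤ 0 ∧ X.v ≤ 0)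
    (hY : Y.v ≤ 0) (h : LateC (p ++ X :: Y :: s)) : LateC (p ++ Y :: X :: s) := by
  obtain ⟨t, h1, h2, h3⟩ := h
  rcases suffix_append_cases h1 with h4 | ⟨r, ⟨q, rfl⟩, rfl⟩
  · have hs : ∃ t, t <:+ s ∧ 1 ≤ hC t ∧ ∀ t', t' <:+ t → hB t' ≤ 0 := by
      rcases List.suffix_cons_iff.1 h4 with rfl | h4
      · simp at h2
        exact ⟨s, List.suffix_rfl, by omega, fun t' ht' => h3 t' (ht'.trans ⟨[X, Y], rfl⟩)⟩
      · rcases List.suffix_cons_iff.1 h4 with rfl | h4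
        · simp at h2
          exact ⟨s, List.suffix_rfl, by omega, fun t' ht' => h3 t' (ht'.trans ⟨[Y], rfl⟩)⟩
        · exact ⟨t, h4, h2, h3⟩
    obtain ⟨t, h5, h6⟩ := hs
    exact ⟨t, h5.trans ⟨p ++ [Y, X], by simp⟩, h6⟩
  · refine ⟨r ++ Y :: X :: s, ⟨q, by simp⟩, by simp at h2 ⊢; omega, fun t' ht' => ?_⟩
    have hs := h3 s ⟨r ++ [X, Y], by simp⟩
    rcases suffix_append_cases ht' with h5 | ⟨r', ⟨q', rfl⟩, rfl⟩
    · have hXY := h3 (X :: Y :: s) (List.suffix_append _ _)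
      simp at hXY
      rcases List.suffix_cons_iff.1 h5 with rfl | h5
      · simp; omega
      · rcases List.suffix_cons_iff.1 h5 with rfl | h5
        · simp; omega
        · exact h3 t' (h5.trans ⟨r ++ [X, Y], by simp⟩)
    · have := h3 (r' ++ X :: Y :: s) ⟨q', by simp⟩
      simp at this ⊢; omega

theorem LateB.exchange {p s : List Letter} {X Y : Letter} (hX : X.u ≤ 0 ∧ X.v ≤ 0)
    (hY : Y.u ≤ 0) (h : LateB (p ++ X :: Y :: s)) : LateB (p ++ Y :: X :: s) := by
  rw [← lateC_sw] at h ⊢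
  have := LateC.exchange (p := sw p) (s := sw s) (X := X.swap) (Y := Y.swap)
    (by simpa using hX.symm) (by simpa using hY) (by simpa using h)
  simpa using this

theorem Good.exchange {p y : List Letter} (hG : Good (p ++ b :: c :: y)) :
    Good (p ++ c :: b :: y) := by
  have hs := hG.safe
  have hb := hG.hB_eq
  have hc := hG.hC_eq
  simp at hs hb hc
  have h0 := hs.2.2.2.2.2.start
  refine ⟨?_, by simp; omega, by simp; omega, fun q s e => ?_⟩
  · simp
    refine ⟨hs.1, by omega, by omega, by omega, by omega, hs.2.2.2.2.2⟩
  · rcases append_cons_split e.symm with ⟨m, rfl, rfl⟩ | ⟨m, rfl, e2⟩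
    · exact hG.merged q (m ++ b :: c :: y) (by simp)
    · rcases m with _ | ⟨_, _ | ⟨_, m⟩⟩
      · simp at e2
      · simp at e2
      · simp only [List.cons_append, List.cons.injEq] at e2
        obtain ⟨rfl, rfl, rfl⟩ := e2
        have := hG.merged (p ++ b :: c :: m) s (by simp)
        exact ⟨fun h => this.1 (h.exchange (by simp) (by simp)),
          fun h => this.2 (h.exchange (by simp) (by simp))⟩

@[simp] theorem hB_replicate_b (s : ℕ) : hB (List.replicate s b) = -s := by
  induction s with
  | zero => simp
  | succ n ih => simp [List.replicate_succ, ih]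

@[simp] theorem hC_replicate_b (s : ℕ) : hC (List.replicate s b) = 0 := by
  induction s with
  | zero => simp
  | succ n ih => simp [List.replicate_succ, ih]

theorem lateC_replicate_b (x : List Letter) (s : ℕ) :
    LateC (x ++ a :: List.replicate (s + 1) b) := by
  refine ⟨a :: List.replicate (s + 1) b, List.suffix_append _ _, by simp, fun t ht => ?_⟩
  rcases List.suffix_cons_iff.1 ht with rfl | ht
  · simp
  · rw [(List.suffix_replicate_iff.1 ht).2]
    simp

theorem exists_replicate_b (t : List Letter) : ∃ s r, t = List.replicate s b ++ r ∧
    ∀ Z r', r = Z :: r' → Z ≠ b := by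
  induction t with
  | nil => exact ⟨0, [], by simp⟩
  | cons Z t ih =>
    by_cases hZ : Z = b
    · obtain ⟨s, r, rfl, h⟩ := ih
      exact ⟨s + 1, r, by simp [List.replicate_succ, hZ], h⟩
    · exact ⟨0, Z :: t, by simp, by simp [hZ]⟩

/-- Induction on the run of `b`: the `c` moves left past one `b` at a time, each move allowed by
lateness of `a b … b`, until it meets `a b` and the closed piece `abc` can be removed. -/
theorem steps_sw_replicate_b {N : ℕ}
    (ih : ∀ w : List Letter, w.length < N → Good w → Steps w.length w (sw w)) (s : ℕ) :
    ∀ x y : List Letter, (x ++ a :: (List.replicate (s + 1) b ++ c :: y)).length = N →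
      Good (x ++ a :: (List.replicate (s + 1) b ++ c :: y)) →
      Steps (x ++ a :: (List.replicate (s + 1) b ++ c :: y)).length
        (x ++ a :: (List.replicate (s + 1) b ++ c :: y))
        (sw (x ++ a :: (List.replicate (s + 1) b ++ c :: y))) := by
  induction s with
  | zero =>
    intro x y hN hG
    have hG' : Good (x ++ ([a, b, c] ++ y)) := by simpa using hG
    have := steps_sw_insert neutral_abc (hG'.of_insert neutral_abc)
      (ih _ (by simp at hN ⊢; omega) (hG'.of_insert neutral_abc))
    simpa using this
  | succ s ihs =>
    intro x y hN hG
    have e : ∀ z, x ++ a :: (List.replicate (s + 1 + 1) b ++ z) =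
        (x ++ a :: List.replicate (s + 1) b) ++ b :: z := by
      intro z
      simp [List.replicate_succ' (n := s + 1)]
    rw [e] at hG hN ⊢
    refine steps_sw_of_cross hG.exchange (lateC_replicate_b x s) ?_
    have := ihs x (b :: y) (by simp at hN ⊢; omega) (by simpa using hG.exchange)
    simpa using this

theorem exists_last_of_mem {w : List Letter} (h : a ∈ w) : ∃ x t, w = x ++ a :: t ∧ a ∉ t := by
  induction w with
  | nil => simp at h
  | cons Z w ih =>
    by_cases hw : a ∈ w
    · obtain ⟨x, t, rfl, h'⟩ := ih hw
      exact ⟨Z :: x, t, rfl, h'⟩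
    · have : a = Z := by simpa [hw] using h
      exact ⟨[], w, by simp [this], hw⟩

/-- The letters after the last `a` contain its match: a `d` at once, or a run of `b` up to a
`c`. -/
theorem Good.after_last_b {x t : List Letter} (hG : Good (x ++ a :: b :: t)) (ha : a ∉ t)
    (hbar : Letter.bar ∉ t) : ∃ s y, b :: t = List.replicate (s + 1) b ++ c :: y := by
  obtain ⟨s, r, rfl, hr⟩ := exists_replicate_b t
  have e : b :: (List.replicate s b ++ r) = List.replicate (s + 1) b ++ r := by
    simp [List.replicate_succ]
  rw [e] at hG ⊢
  refine ⟨s, ?_⟩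
  rcases r with _ | ⟨Z, r⟩
  · have hx := (safe_append.1 hG.safe).1.last
    have := hG.hC_eq
    simp at this; omega
  · cases Z
    · simp at ha
    · exact absurd rfl (hr _ _ rfl)
    · exact ⟨r, rfl⟩
    · exact absurd (lateC_replicate_b x s)
        (hG.merged (x ++ a :: List.replicate (s + 1) b) r (by simp)).2
    · simp at hbar

/-- As many promotion steps as there are letters exchange `b` and `c`. -/
theorem steps_sw {w : List Letter} (hG : Good w) : Steps w.length w (sw w) := by
  induction hN : w.length using Nat.strong_induction_on generalizing w with
  | _ N ih =>
    rw [← hN]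
    have ih' : ∀ w : List Letter, w.length < N → Good w → Steps w.length w (sw w) :=
      fun w h hw => ih _ h hw rfl
    by_cases hbar : Letter.bar ∈ w
    · obtain ⟨x, y, rfl⟩ := List.append_of_mem hbar
      have hG' := Good.of_insert (x := x) (y := y) neutral_bar (by simpa using hG)
      have := steps_sw_insert neutral_bar hG' (ih' _ (by simp at hN ⊢; omega) hG')
      simpa using this
    by_cases ha : a ∈ w
    · obtain ⟨x, t, rfl, ht⟩ := exists_last_of_mem ha
      rcases t with _ | ⟨Z, t⟩
      · have hx := (safe_append.1 hG.safe).1.last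
        have := hG.hC_eq
        simp at this; omega
      · simp at hbar ht
        cases Z
        · simp at ht
        · obtain ⟨s, y, e⟩ := hG.after_last_b (by tauto) (by tauto)
          rw [e] at hG hN ⊢
          exact steps_sw_replicate_b ih' s x y hN hG
        -- The case of a `c` after the last `a` is the mirror image of the case of a `b`.
        · have hG' : Good (sw x ++ a :: b :: sw t) := by simpa using hG.sw
          have hm (Z : Letter) (hZ : Z.swap = Z) (h : Z ∈ sw t) : Z ∈ t := by
            obtain ⟨Y, hY, rfl⟩ := List.mem_map.1 h
            rw [swap_swap] at hZ
            rwa [← hZ]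
          obtain ⟨s, y, e⟩ := hG'.after_last_b (fun h => ht.2 (hm _ rfl h))
            (fun h => hbar.2.2 (hm _ rfl h))
          rw [e] at hG'
          have h2 := (steps_sw_replicate_b ih' s (sw x) y
            (by rw [← e]; simpa using hN) hG').sw
          rw [← e] at h2
          simpa using h2
        · have hG' := Good.of_insert (x := x) (y := t) neutral_ad (by simpa using hG)
          have := steps_sw_insert neutral_ad hG' (ih' _ (by simp at hN ⊢; omega) hG')
          simpa using this
        · simp at hbar
    · rcases w with _ | ⟨Z, w⟩
      · rfl
      · have := hG.safe.2.2.start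
        cases Z <;> simp at *

/-! ### Standard words -/

/-- Words in which every block ends with its letters `a`, and in which the other letters of a
block are in a fixed order, which depends on what precedes them. -/
structure Tidy (w : List Letter) : Prop where
  safe : Safe 0 0 w
  merged : ∀ p s, w = p ++ d :: s → ¬ LateB p ∧ ¬ LateC p
  after_a : ∀ p X s, w = p ++ a :: X :: s → X = a ∨ X = Letter.bar
  lateB : ∀ p s, w = p ++ b :: c :: s → LateB p
  lateC : ∀ p s, w = p ++ c :: b :: s → LateC p

theorem swap_eq_iff {X Y : Letter} : X.swap = Y ↔ X = Y.swap := by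
  constructor <;> rintro rfl <;> simp

theorem Tidy.sw {w : List Letter} (h : Tidy w) : Tidy (sw w) where
  safe := safe_sw.2 h.safe
  merged p s e := by
    have := h.merged (VWord.sw p) (VWord.sw s) (by rw [← sw_sw w, e]; simp)
    rw [lateB_sw, lateC_sw] at this
    exact this.symm
  after_a p X s e := by
    have := h.after_a (VWord.sw p) X.swap (VWord.sw s) (by rw [← sw_sw w, e]; simp)
    rwa [swap_eq_iff, swap_eq_iff] at this
  lateB p s e := by
    have := h.lateC (VWord.sw p) (VWord.sw s) (by rw [← sw_sw w, e]; simp)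
    rwa [lateC_sw] at this
  lateC p s e := by
    have := h.lateB (VWord.sw p) (VWord.sw s) (by rw [← sw_sw w, e]; simp)
    rwa [lateB_sw] at this

/-- The invariant of promotion steps on words. The last field says where the last letter was
before the step that appended it. -/
structure Standard (w : List Letter) : Prop extends Tidy w where
  hB_eq : hB w = 0
  hC_eq : hC w = 0
  origin : ∀ y X, w = a :: y ++ [X] → X ≠ Letter.bar → ∃ y₁ z, y = y₁ ++ a :: z ∧
    (hB (a :: y₁) ≤ 0 ∨ hC (a :: y₁) ≤ 0) ∧ (X = b → hB z = 0) ∧ (X = c → hC z = 0)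

theorem Standard.good {w : List Letter} (h : Standard w) : Good w :=
  ⟨h.safe, h.hB_eq, h.hC_eq, h.merged⟩

theorem Standard.sw {w : List Letter} (h : Standard w) : Standard (sw w) where
  toTidy := h.toTidy.sw
  hB_eq := by simpa using h.hC_eq
  hC_eq := by simpa using h.hB_eq
  origin y X e hX := by
    obtain ⟨y₁, z, e', h1, h2, h3⟩ := h.origin (VWord.sw y) X.swap
      (by rw [← sw_sw w, e]; simp) (by simpa [swap_eq_iff] using hX)
    refine ⟨VWord.sw y₁, VWord.sw z, by rw [← sw_sw y, e']; simp, by simpa using h1.symm,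
      fun e => ?_, fun e => ?_⟩
    · simpa using h3 (by simp [e])
    · simpa using h2 (by simp [e])

theorem Standard.suffix {w s : List Letter} (h : Standard w) (hs : s <:+ w) :
    hB s ≤ 0 ∧ hC s ≤ 0 := by
  have := h.safe.suffix hs
  have := h.hB_eq
  have := h.hC_eq
  omega

/-- After the hit letter some height is `0`, so the same letter or a `d` cannot follow. The mixed
pairs `b c` and `c b` are excluded by their lateness condition, which makes the height before the
hit too large. After a hit `d` both heights are `0`. -/
theorem Standard.hit_next {x z : List Letter} {X : Letter} (h : Standard (a :: (x ++ X :: z)))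
    (hh : Hit x X) : ∃ Y z', z = Y :: z' ∧ (Y = a ∨ Y = Letter.bar) := by
  have hs := h.safe
  have hx := hh.safe
  have hxl := hx.last
  have hhit := hh.hit
  rcases z with _ | ⟨Y, z⟩
  -- The hit letter is not the last letter of the word: `origin` would give a prefix `a :: y₁` with
  -- a nonpositive height inside the part that the leading `a` passes.
  · exfalso
    obtain ⟨y₁, z, rfl, h1, -⟩ := h.origin x X (by simp) (by
      rcases hh.nonpos with rfl | rfl | rfl <;> simp)
    have := (safe_append.1 hx).1.last
    simp at h1; omega
  · refine ⟨Y, z, rfl, ?_⟩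
    have h1 : 1 ≤ hB (a :: x) ∧ 1 ≤ hC (a :: x) := by simp; omega
    simp only [safe_cons, safe_append] at hs
    have h2 := hs.2.2.2.2.2.2.2.start
    have hb : X = b → Y ≠ c := by
      rintro rfl rfl
      have := (LateB.two_le hx h1.2 (h.lateB (a :: x) z (by simp))).1
      simp at hhit; omega
    have hc : X = c → Y ≠ b := by
      rintro rfl rfl
      have := (LateC.two_le hx h1.1 (h.lateC (a :: x) z (by simp))).1
      simp at hhit; omega
    have hd : X = d → hB x = 0 ∧ hC x = 0 := by
      rintro rfl
      exact h.good.hit_d hh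
    rcases hh.nonpos with rfl | rfl | rfl <;> cases Y <;> simp at * <;> omega

theorem append_singleton_split {α : Type*} {z m s : List α} {X Y : α}
    (h : z ++ [X] = m ++ Y :: s) :
    (s = [] ∧ z = m ∧ X = Y) ∨ ∃ s', s = s' ++ [X] ∧ z = m ++ Y :: s' := by
  rcases append_cons_split h.symm with ⟨n, rfl, rfl⟩ | ⟨n, rfl, h2⟩
  · exact Or.inr ⟨n, rfl, rfl⟩
  · rcases n with _ | ⟨Z, n⟩
    · simp at h2
      exact Or.inl ⟨h2.2, by simp, h2.1⟩
    · simp at h2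

/-- The only new `a` takes the place of the hit letter, and `hit_next` controls what follows it. No
`a` comes right before the appended letter, because a word of total height `0` cannot end with `a`.
-/
theorem Standard.after_a_step {w w' : List Letter} (h : Standard w) (hs : Step w w') :
    ∀ p X s, w' = p ++ a :: X :: s → X = a ∨ X = Letter.bar := by
  intro p W s e
  cases hs with
  | bar x =>
    rcases append_singleton_split e with ⟨⟨⟩, -⟩ | ⟨s', e', rfl⟩
    rcases s' with _ | ⟨Z, s'⟩
    · simp at e'
      exact Or.inr e'.1
    · simp only [List.cons_append, List.cons.injEq] at e'
      obtain ⟨rfl, rfl⟩ := e'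
      exact h.after_a (Letter.bar :: p) W s' (by simp)
  | @hit x X z hh =>
    obtain ⟨Y, z', rfl, hY⟩ := h.hit_next hh
    rcases append_cons_split e.symm with ⟨m, rfl, e2⟩ | ⟨m, rfl, e2⟩
    · rcases m with _ | ⟨V, m⟩
      · simp at e2
        exact Or.inl e2.1
      · simp only [List.cons_append, List.cons.injEq] at e2
        obtain ⟨rfl, rfl⟩ := e2
        exact h.after_a (a :: p) W (m ++ X :: Y :: z') (by simp)
    · rcases m with _ | ⟨V, m⟩
      · simp at e2
        rw [← e2.1]; exact hY
      · simp only [List.cons_append, List.cons.injEq] at e2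
        obtain ⟨rfl, e2⟩ := e2
        have e2' : (Y :: z') ++ [X] = (m ++ [a]) ++ W :: s := by simp [e2]
        rcases append_singleton_split e2' with ⟨rfl, e3, rfl⟩ | ⟨s', rfl, e3⟩
        · exfalso
          rw [e3] at h
          have := h.suffix (s := [a]) ⟨a :: (x ++ X :: m), by simp⟩
          simp at this
        · rw [e3] at h
          exact h.after_a (a :: (x ++ X :: m)) W s' (by simp)

/-- Old pairs keep their lateness by `LateB.two_le` before the hit and by `LateB.of_hit` after it. A
pair can be new only at the end, when a `c` is appended to a final `b`; `origin` then supplies the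
`a` that replaced this `b` earlier, and the suffix starting there is the witness. -/
theorem Standard.lateB_step {w w' : List Letter} (h : Standard w) (hs : Step w w') :
    ∀ p s, w' = p ++ b :: c :: s → LateB p := by
  intro p s e
  cases hs with
  | bar x =>
    rcases append_singleton_split e with ⟨⟨⟩, -⟩ | ⟨s', e', rfl⟩
    rcases s' with _ | ⟨Z, s'⟩
    · simp at e'
    · simp only [List.cons_append, List.cons.injEq] at e'
      obtain ⟨rfl, rfl⟩ := e'
      exact (h.lateB (Letter.bar :: p) s' (by simp)).of_bar
  | @hit x X z hh =>
    have hhit := hh.hit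
    have hS := h.safe
    have hx := hh.safe
    have hxl := hx.last
    rcases append_cons_split e.symm with ⟨m, rfl, e2⟩ | ⟨m, rfl, e2⟩
    · rcases m with _ | ⟨V, m⟩
      · simp at e2
      · simp only [List.cons_append, List.cons.injEq] at e2
        obtain ⟨rfl, rfl⟩ := e2
        have hp := (safe_append.1 hx).1
        have hpl := hp.last
        exact (LateB.two_le hp (by simp; omega) (h.lateB (a :: p) (m ++ X :: z) (by simp))).2
    · rcases m with _ | ⟨V, m⟩
      · simp at e2
      · simp only [List.cons_append, List.cons.injEq] at e2
        obtain ⟨rfl, e2⟩ := e2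
        have e2' : z ++ [X] = (m ++ [b]) ++ c :: s := by simp [e2]
        rcases append_singleton_split e2' with ⟨rfl, rfl, rfl⟩ | ⟨s', rfl, rfl⟩
        · obtain ⟨y₁, z, e3, h1, h2, h3⟩ := h.origin (x ++ c :: m) b (by simp) (by simp)
          have h2 := h2 rfl
          rcases append_cons_split e3 with ⟨g, rfl, rfl⟩ | ⟨g, rfl, e4⟩
          · have hC0 := h.hC_eq
            simp at hhit hS hC0
            have hg := hS.2.2.2.1.last
            refine ⟨a :: z, ⟨x ++ a :: g, by simp⟩, by simp; omega, fun t ht => ?_⟩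
            rcases List.suffix_cons_iff.1 ht with rfl | ht
            · simp; omega
            · obtain ⟨r, rfl⟩ := ht
              have := h.suffix (s := t ++ [b]) ⟨a :: (x ++ c :: g ++ a :: r), by simp⟩
              simp at this
              omega
          · have := (safe_append.1 hx).1.last
            simp at h1; omega
        · simp at hS
          have h4 := hS.2.2.2.2.2.2.2.2.start
          have := LateB.of_hit (m := m) hh (by simp; omega) (by simp; omega)
            (h.lateB (a :: (x ++ X :: m)) s' (by simp))
          exact this.mono ⟨x ++ [a], by simp⟩

theorem Standard.step {w w' : List Letter} (h : Standard w) (hs : Step w w') : Standard w' where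
  safe := (h.good.step hs).safe
  merged := (h.good.step hs).merged
  hB_eq := (h.good.step hs).hB_eq
  hC_eq := (h.good.step hs).hC_eq
  after_a := h.after_a_step hs
  lateB := h.lateB_step hs
  lateC p s e := by
    have := h.sw.lateB_step hs.sw (VWord.sw p) (VWord.sw s) (by rw [e]; simp)
    rwa [lateB_sw] at this
  origin y Y e hY := by
    have hb := h.hB_eq
    have hc := h.hC_eq
    cases hs with
    | bar x =>
      have := (List.append_inj' e rfl).2
      simp at this
      exact absurd this.symm hY
    | @hit x X z hh =>
      have hhit := hh.hit
      have hxl := hh.safe.last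
      have e' : (x ++ a :: z) ++ [X] = (a :: y) ++ [Y] := by simpa using e
      obtain ⟨e1, e2⟩ := List.append_inj' e' rfl
      simp at e2
      subst e2
      -- A hit directly after the leading `a` would contradict `after_a`.
      rcases x with _ | ⟨L, x⟩
      · exfalso
        have := h.after_a [] X z rfl
        rcases hh.nonpos with rfl | rfl | rfl <;> simp at this
      · simp only [List.cons_append, List.cons.injEq] at e1
        obtain ⟨rfl, rfl⟩ := e1
        refine ⟨x, z, rfl, ?_, ?_, ?_⟩
        · rcases hh.nonpos with rfl | rfl | rfl <;> simp at hhit hxl ⊢ <;> omega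
        · rintro rfl
          simp at hhit hxl hb hc ⊢; omega
        · rintro rfl
          simp at hhit hxl hb hc ⊢; omega

end VWord

/-! ### Letter counts up to a given bar -/

/-- The number of `a` in a letter. -/
def Letter.nA : Letter → ℤ
  | .a => 1
  | _ => 0

/-- The number of `b` in a letter. -/
def Letter.nB : Letter → ℤ
  | .b => 1
  | .d => 1
  | _ => 0

/-- The number of `c` in a letter. -/
def Letter.nC : Letter → ℤ
  | .c => 1
  | .d => 1
  | _ => 0

namespace VWord

open Letter

@[simp] theorem nA_a : a.nA = 1 := rfl
@[simp] theorem nB_a : a.nB = 0 := rfl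
@[simp] theorem nC_a : a.nC = 0 := rfl
@[simp] theorem nA_bar : Letter.bar.nA = 0 := rfl
@[simp] theorem nB_bar : Letter.bar.nB = 0 := rfl
@[simp] theorem nC_bar : Letter.bar.nC = 0 := rfl
@[simp] theorem nA_swap (x : Letter) : x.swap.nA = x.nA := by cases x <;> rfl
@[simp] theorem nB_swap (x : Letter) : x.swap.nB = x.nC := by cases x <;> rfl
@[simp] theorem nC_swap (x : Letter) : x.swap.nC = x.nB := by cases x <;> rfl

/-- The sum of the weights of the letters of a word. -/
def wt (φ : Letter → ℤ) (w : List Letter) : ℤ := (w.map φ).sum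

@[simp] theorem wt_nil (φ) : wt φ [] = 0 := rfl
@[simp] theorem wt_cons (φ) (x w) : wt φ (x :: w) = φ x + wt φ w := by simp [wt]
@[simp] theorem wt_append (φ) (w w') : wt φ (w ++ w') = wt φ w + wt φ w' := by simp [wt]

theorem wt_sub_wt_nB (w : List Letter) : wt nA w - wt nB w = hB w := by
  induction w with
  | nil => rfl
  | cons x w ih => rw [hB_cons, ← ih]; cases x <;> simp [nA, nB] <;> ring

theorem wt_sub_wt_nC (w : List Letter) : wt nA w - wt nC w = hC w := by
  induction w with
  | nil => rfl
  | cons x w ih => rw [hC_cons, ← ih]; cases x <;> simp [nA, nC] <;> ring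

theorem wt_nA_nonneg (w : List Letter) : 0 ≤ wt nA w := by
  induction w with
  | nil => simp
  | cons x w ih => cases x <;> simp [nA] <;> omega

theorem wt_nA_eq_zero {w : List Letter} (h : a ∉ w) : wt nA w = 0 := by
  induction w with
  | nil => simp
  | cons x w ih => cases x <;> simp_all [nA]

/-- The sum of the weights of the letters before the `k`-th bar. -/
def cum (φ : Letter → ℤ) : ℕ → List Letter → ℤ
  | 0, _ => 0
  | _ + 1, [] => 0
  | k + 1, x :: w => if x = Letter.bar then cum φ k w else φ x + cum φ (k + 1) w

@[simp] theorem cum_zero (φ) (w) : cum φ 0 w = 0 := by cases w <;> rfl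

@[simp] theorem cum_nil (φ) (k) : cum φ k [] = 0 := by cases k <;> rfl

@[simp] theorem cum_succ_bar (φ) (k w) : cum φ (k + 1) (Letter.bar :: w) = cum φ k w := by
  simp [cum]

theorem cum_succ_cons (φ) {x : Letter} (hx : x ≠ Letter.bar) (k w) :
    cum φ (k + 1) (x :: w) = φ x + cum φ (k + 1) w := by simp [cum, hx]

theorem cum_append_add {φ : Letter → ℤ} (hφ : φ Letter.bar = 0) (p r : List Letter) (k : ℕ) :
    cum φ (p.count Letter.bar + (k + 1)) (p ++ r) = wt φ p + cum φ (k + 1) r := by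
  induction p with
  | nil => simp
  | cons x p ih =>
    by_cases hx : x = Letter.bar
    · subst hx
      rw [List.count_cons_self, List.cons_append, add_right_comm, cum_succ_bar, ih]
      simp [hφ]
    · rw [List.count_cons_of_ne hx, List.cons_append, ← add_assoc, cum_succ_cons φ hx, add_assoc,
        ih]
      simp [add_assoc]

theorem cum_append_of_le (φ : Letter → ℤ) {p : List Letter} (r : List Letter) {k : ℕ}
    (hk : k ≤ p.count Letter.bar) : cum φ k (p ++ r) = cum φ k p := by
  induction p generalizing k with
  | nil => simp at hk; simp [hk]
  | cons x p ih =>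
    rcases k with _ | k
    · simp
    by_cases hx : x = Letter.bar
    · subst hx
      simp at hk
      simp [ih hk]
    · rw [List.count_cons_of_ne hx] at hk
      rw [List.cons_append, cum_succ_cons φ hx, cum_succ_cons φ hx, ih hk]

theorem cum_append_bar {φ : Letter → ℤ} (hφ : φ Letter.bar = 0) (p r : List Letter) :
    cum φ (p.count Letter.bar + 1) (p ++ Letter.bar :: r) = wt φ p := by
  simpa using cum_append_add hφ p (Letter.bar :: r) 0

theorem cum_sw {φ ψ : Letter → ℤ} (h : ∀ x : Letter, φ x.swap = ψ x) (k : ℕ) (w : List Letter) :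
    cum φ k (sw w) = cum ψ k w := by
  induction w generalizing k with
  | nil => simp
  | cons x w ih =>
    rcases k with _ | k
    · simp
    · by_cases hx : x = Letter.bar
      · subst hx; simp [ih]
      · rw [sw_cons, cum_succ_cons φ (by simpa [swap_eq_iff] using hx), cum_succ_cons ψ hx, ih, h]

theorem exists_split_bar {x : List Letter} {i : ℕ} (h : i < x.count Letter.bar) :
    ∃ x₁ x₂, x = x₁ ++ Letter.bar :: x₂ ∧ x₁.count Letter.bar = i := by
  induction x generalizing i with
  | nil => simp at h
  | cons y x ih =>
    by_cases hy : y = Letter.bar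
    · subst hy
      rcases i with _ | i
      · exact ⟨[], x, rfl, rfl⟩
      · obtain ⟨x₁, x₂, rfl, rfl⟩ := ih (i := i) (by simpa using h)
        exact ⟨Letter.bar :: x₁, x₂, rfl, by simp⟩
    · rw [List.count_cons_of_ne hy] at h
      obtain ⟨x₁, x₂, rfl, rfl⟩ := ih h
      exact ⟨y :: x₁, x₂, rfl, by rw [List.count_cons_of_ne hy]⟩

theorem exists_trailing_a (w : List Letter) :
    ∃ p m, w = p ++ List.replicate m a ∧ ∀ p', p ≠ p' ++ [a] := by
  induction w using List.reverseRecOn with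
  | nil => exact ⟨[], 0, by simp, by simp⟩
  | append_singleton w x ih =>
    by_cases hx : x = a
    · obtain ⟨p, m, rfl, h⟩ := ih
      exact ⟨p, m + 1, by simp [List.replicate_succ', hx], h⟩
    · refine ⟨w ++ [x], 0, by simp, fun p' h => hx ?_⟩
      simpa using (List.append_inj' h rfl).2

/-- The letters `a` before the last bar of `p` are all of `p`, if `p` does not end with `a`. -/
theorem Tidy.cum_nA {p r : List Letter} (h : Tidy (p ++ r)) (hp : ∀ p', p ≠ p' ++ [a]) :
    cum nA (p.count Letter.bar) (p ++ r) = wt nA p := by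
  have key : ∀ p₁ p₂, p = p₁ ++ p₂ → Letter.bar ∉ p₂ → a ∉ p₂ := by
    rintro p₁ p₂ rfl hbar ha
    obtain ⟨y, t, rfl, ht⟩ := exists_last_of_mem ha
    rcases t with _ | ⟨Y, t⟩
    · exact hp (p₁ ++ y) (by simp)
    · rcases h.after_a (p₁ ++ y) Y (t ++ r) (by simp) with rfl | rfl
      · simp at ht
      · simp at hbar
  by_cases h0 : Letter.bar ∈ p
  · have : Letter.bar ∈ p.reverse := by simpa using h0
    obtain ⟨u₁, u₂, hu, hb⟩ := List.eq_append_cons_of_mem this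
    have e : p = u₂.reverse ++ Letter.bar :: u₁.reverse := by
      rw [← List.reverse_reverse p, hu]; simp
    have hb' : Letter.bar ∉ u₁.reverse := by simpa using hb
    have ha := key (u₂.reverse ++ [Letter.bar]) u₁.reverse (by simp [e]) hb'
    rw [e]
    have := cum_append_bar (φ := nA) rfl u₂.reverse (u₁.reverse ++ r)
    rw [List.count_append, List.count_cons_self, List.count_eq_zero_of_not_mem hb', zero_add]
    simpa [wt_nA_eq_zero ha] using this
  · rw [List.count_eq_zero_of_not_mem h0, cum_zero, wt_nA_eq_zero (key [] p rfl h0)]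

theorem cum_trailing_a {φ : Letter → ℤ} (hφ : φ Letter.bar = 0) (ha : φ a = 0)
    (p r : List Letter) (m : ℕ) :
    cum φ (p.count Letter.bar + 1) (p ++ (List.replicate m a ++ Letter.bar :: r)) = wt φ p := by
  have h1 := cum_append_bar hφ (p ++ List.replicate m a) r
  have h2 : (List.replicate m a).count Letter.bar = 0 := by
    rw [List.count_eq_zero]; simp [List.mem_replicate]
  have h3 : wt φ (List.replicate m a) = 0 := by simp [wt, ha]
  rw [List.count_append, h2] at h1
  simpa [h3] using h1

/-- Just before the final run of `a` in a block, the height compares the `a` of all earlier blocks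
with the `b` up to and including this block. The shift of index by one is the strictness of
labelings. -/
theorem Tidy.hB_eq_cum {p r : List Letter} {m : ℕ}
    (h : Tidy (p ++ (List.replicate m a ++ Letter.bar :: r))) (hp : ∀ p', p ≠ p' ++ [a]) :
    hB p = cum nA (p.count Letter.bar) (p ++ (List.replicate m a ++ Letter.bar :: r)) -
      cum nB (p.count Letter.bar + 1) (p ++ (List.replicate m a ++ Letter.bar :: r)) := by
  rw [h.cum_nA hp, cum_trailing_a rfl rfl, wt_sub_wt_nB]

theorem Tidy.hC_eq_cum {p r : List Letter} {m : ℕ}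
    (h : Tidy (p ++ (List.replicate m a ++ Letter.bar :: r))) (hp : ∀ p', p ≠ p' ++ [a]) :
    hC p = cum nA (p.count Letter.bar) (p ++ (List.replicate m a ++ Letter.bar :: r)) -
      cum nC (p.count Letter.bar + 1) (p ++ (List.replicate m a ++ Letter.bar :: r)) := by
  rw [h.cum_nA hp, cum_trailing_a rfl rfl, wt_sub_wt_nC]

/-- Only letters `a` come between the hit letter and the next bar. -/
theorem Standard.hit_next_bar {x z : List Letter} {X : Letter} (h : Standard (a :: (x ++ X :: z)))
    (hh : Hit x X) : ∃ m r, z = List.replicate m a ++ Letter.bar :: r := by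
  have key : ∀ t p, a :: (x ++ X :: z) = p ++ a :: t →
      ∃ m r, t = List.replicate m a ++ Letter.bar :: r := by
    intro t
    induction t with
    | nil =>
      intro p e
      have := h.suffix (s := [a]) ⟨p, e.symm⟩
      simp at this
    | cons Y t ih =>
      intro p e
      rcases h.after_a p Y t e with rfl | rfl
      · obtain ⟨m, r, rfl⟩ := ih (p ++ [a]) (by simp [e])
        exact ⟨m + 1, r, by simp [List.replicate_succ]⟩
      · exact ⟨0, t, rfl⟩
  obtain ⟨Y, z', rfl, rfl | rfl⟩ := h.hit_next hh
  · obtain ⟨m, r, rfl⟩ := key z' (a :: (x ++ [X])) (by simp)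
    exact ⟨m + 1, r, by simp [List.replicate_succ]⟩
  · exact ⟨0, z', rfl⟩

/-- Before the block of the hit letter, all heights at the ends of blocks are positive. -/
theorem Tidy.cum_lt_of_safe {x z : List Letter} (h : Tidy (a :: (x ++ z))) (hx : Safe 0 0 x)
    {e : ℕ} (he : 1 ≤ e) (he' : e < x.count Letter.bar) :
    cum nB (e + 1) (a :: (x ++ z)) ≤ cum nA e (a :: (x ++ z)) - 1 ∧
      cum nC (e + 1) (a :: (x ++ z)) ≤ cum nA e (a :: (x ++ z)) - 1 := by
  obtain ⟨x₁, x₂, rfl, rfl⟩ := exists_split_bar he'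
  obtain ⟨p, m, hp, hp'⟩ := exists_trailing_a (a :: x₁)
  have e : a :: (x₁ ++ Letter.bar :: x₂ ++ z) =
      p ++ (List.replicate m a ++ Letter.bar :: (x₂ ++ z)) := by
    rw [← List.append_assoc, ← hp]; simp
  have hc : x₁.count Letter.bar = p.count Letter.bar := by
    have := congrArg (List.count Letter.bar) hp
    have h2 : (List.replicate m a).count Letter.bar = 0 := by
      rw [List.count_eq_zero]; simp [List.mem_replicate]
    rwa [List.count_append, h2, List.count_cons_of_ne (by simp)] at this
  rw [e] at h ⊢
  have h1 := h.hB_eq_cum hp'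
  have h2 := h.hC_eq_cum hp'
  rw [hc] at he ⊢
  rcases p with _ | ⟨Y, p⟩
  · simp at he
  · simp only [List.cons_append, List.cons.injEq] at hp
    obtain ⟨rfl, rfl⟩ := hp
    simp only [safe_append] at hx
    have := hx.1.1.last
    simp only [hB_cons, hC_cons, u_a, v_a] at h1 h2
    omega

/-- Only letters `a` follow the hit letter in its block, so the heights right after it can be read
off from the counts. The block is not the first one, because the leading `a` would have to be
counted before the zeroth bar. -/
theorem Standard.cum_hit {x z : List Letter} {X : Letter} (h : Standard (a :: (x ++ X :: z)))
    (hh : Hit x X) : 1 ≤ x.count Letter.bar ∧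
      hB x + 1 + X.u = cum nA (x.count Letter.bar) (a :: (x ++ X :: z)) -
        cum nB (x.count Letter.bar + 1) (a :: (x ++ X :: z)) ∧
      hC x + 1 + X.v = cum nA (x.count Letter.bar) (a :: (x ++ X :: z)) -
        cum nC (x.count Letter.bar + 1) (a :: (x ++ X :: z)) := by
  obtain ⟨m, r, rfl⟩ := h.hit_next_bar hh
  have hX : X ≠ a ∧ X ≠ Letter.bar := by rcases hh.nonpos with rfl | rfl | rfl <;> simp
  have e : a :: (x ++ X :: (List.replicate m a ++ Letter.bar :: r)) =
    (a :: (x ++ [X])) ++ (List.replicate m a ++ Letter.bar :: r) := by simp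
  have hp : ∀ p', a :: (x ++ [X]) ≠ p' ++ [a] := by
    intro p' hp
    rw [← List.cons_append] at hp
    have := (List.append_inj' hp rfl).2
    simp at this
    exact hX.1 this
  have hc : (a :: (x ++ [X])).count Letter.bar = x.count Letter.bar := by
    rw [List.count_cons_of_ne (by simp), List.count_append,
      List.count_eq_zero_of_not_mem (l := [X])]
    · rfl
    · simpa using hX.2.symm
  have ht := h.toTidy
  rw [e] at ht ⊢
  have h1 := ht.hB_eq_cum hp
  have h2 := ht.hC_eq_cum hp
  have h3 := ht.cum_nA hp
  rw [hc] at h1 h2 h3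
  refine ⟨?_, by rw [← h1]; simp; ring, by rw [← h2]; simp; ring⟩
  by_contra h0
  have h0 : x.count Letter.bar = 0 := by omega
  have := wt_nA_nonneg (x ++ [X])
  rw [h0, cum_zero, wt_cons, nA_a] at h3
  omega

end VWord

/-! ### One row of promotion on counts -/

/-- The rule of promotion on the numbers `al k`, `be k`, `ga k` of labels at most `k` at `A`, `B`
and `C`. -/
structure PromotionRow (q : ℕ) (al be ga al' be' ga' : ℕ → ℤ) : Prop where
  al_zero : al' 0 = 0
  be_zero : be' 0 = 0
  ga_zero : ga' 0 = 0
  al_succ : ∀ k, k + 1 < q →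
    al' (k + 1) + al (k + 1) = al (k + 2) + max (al' k) (max (be (k + 2)) (ga (k + 2)))
  be_succ : ∀ k, k + 1 < q → be' (k + 1) + be (k + 1) = be' k + min (be (k + 2)) (al' k)
  ga_succ : ∀ k, k + 1 < q → ga' (k + 1) + ga (k + 1) = ga' k + min (ga (k + 2)) (al' k)

theorem PromotionRow.unique {q : ℕ} {al be ga al₁ be₁ ga₁ al₂ be₂ ga₂ : ℕ → ℤ}
    (h₁ : PromotionRow q al be ga al₁ be₁ ga₁) (h₂ : PromotionRow q al be ga al₂ be₂ ga₂)
    (k : ℕ) (hk : k < q) : al₁ k = al₂ k ∧ be₁ k = be₂ k ∧ ga₁ k = ga₂ k := by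
  induction k with
  | zero => simp [h₁.al_zero, h₁.be_zero, h₁.ga_zero, h₂.al_zero, h₂.be_zero, h₂.ga_zero]
  | succ k ih =>
    obtain ⟨e1, e2, e3⟩ := ih (by omega)
    have a1 := h₁.al_succ k hk
    have a2 := h₂.al_succ k hk
    have b1 := h₁.be_succ k hk
    have b2 := h₂.be_succ k hk
    have c1 := h₁.ga_succ k hk
    have c2 := h₂.ga_succ k hk
    rw [e1] at a1 b1 c1
    rw [e2] at b1
    rw [e3] at c1
    omega

/-- How the partial sums `B` of a word in the middle of a row differ from the initial ones. -/
def RowPart (q : ℕ) (be A B : ℕ → ℤ) : Prop :=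
  B 1 = be 1 ∧ ∀ e, 1 ≤ e → e < q → B (e + 1) - B e = be (e + 1) - be e - max 0 (be (e + 1) - A e)

/-- The number `max 0 (be (e + 1) - A e)` is how many `b` of block `e + 1` have been replaced so
far. A hit of weight `β` in block `e₀ + 1` raises this deficit by `β` and leaves the others alone.
The last conclusion says that a letter not hit has no deficit there, so that the larger of the
deficits for `b` and `c` also grows by exactly one. -/
theorem RowPart.step {q e₀ : ℕ} {be A B A' B' : ℕ → ℤ} {β : ℤ} (h : RowPart q be A B)
    (he : 1 ≤ e₀) (he' : e₀ < q)
    (hA₁ : ∀ j, 1 ≤ j → j ≤ e₀ → A' j = A j - 1) (hA₂ : ∀ j, e₀ < j → j ≤ q → A' j = A j)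
    (hB₁ : ∀ j, 1 ≤ j → j ≤ e₀ → B' j = B j) (hB₂ : ∀ j, e₀ < j → j ≤ q → B' j = B j - β)
    (hlt : ∀ e, 1 ≤ e → e < e₀ → B (e + 1) ≤ A e - 1)
    (hhit : (β = 1 ∧ B (e₀ + 1) = A e₀) ∨ (β = 0 ∧ B (e₀ + 1) ≤ A e₀ - 1)) :
    RowPart q be A' B' ∧
      (∀ e, 1 ≤ e → e < e₀ → max 0 (be (e + 1) - A e) = 0 ∧ max 0 (be (e + 1) - A' e) = 0) ∧
      max 0 (be (e₀ + 1) - A' e₀) = max 0 (be (e₀ + 1) - A e₀) + β ∧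
      (β = 0 → max 0 (be (e₀ + 1) - A e₀) = 0) := by
  -- Once `B e = be e`, the row relation reads `B (e + 1) = min (be (e + 1)) (A e)`, and `hlt` rules
  -- out that the minimum is `A e`. So there is no deficit before the hit block.
  have low : ∀ e, 1 ≤ e → e ≤ e₀ → B e = be e ∧ (e < e₀ → be (e + 1) ≤ A e - 1) := by
    intro e he1
    induction e, he1 using Nat.le_induction with
    | base =>
      intro _
      refine ⟨h.1, fun h2 => ?_⟩
      have h3 := h.2 1 le_rfl (by omega)
      have h4 := hlt 1 le_rfl h2
      have h5 := h.1
      omega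
    | succ e he1 ih =>
      intro h1
      obtain ⟨h2, h3⟩ := ih (by omega)
      have h3 := h3 (by omega)
      have h4 := h.2 e he1 (by omega)
      have h5 : B (e + 1) = be (e + 1) := by omega
      refine ⟨h5, fun h6 => ?_⟩
      have h7 := h.2 (e + 1) (by omega) (by omega)
      have h8 := hlt (e + 1) (by omega) h6
      omega
  have hl := (low e₀ he le_rfl).1
  have hr := h.2 e₀ he he'
  have a0 := hA₁ e₀ he le_rfl
  refine ⟨⟨?_, fun e h1 h2 => ?_⟩, fun e h1 h2 => ?_, ?_, ?_⟩
  · rw [hB₁ 1 le_rfl he]; exact h.1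
  · have h3 := h.2 e h1 h2
    rcases lt_trichotomy e e₀ with h4 | rfl | h4
    · have := (low e h1 h4.le).2 h4
      rw [hA₁ e h1 h4.le, hB₁ e h1 h4.le, hB₁ (e + 1) (by omega) (by omega)]
      omega
    · rw [a0, hB₁ e h1 le_rfl, hB₂ (e + 1) (by omega) (by omega)]
      omega
    · rw [hA₂ e h4 h2.le, hB₂ e h4 h2.le, hB₂ (e + 1) (by omega) (by omega)]
      omega
  · have := (low e h1 h2.le).2 h2
    rw [hA₁ e h1 h2.le]
    omega
  · omega
  · omega

namespace VWord

open Letter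

/-- The relation between the counts `al`, `be`, `ga` at the start of a row of promotion and a word
in the middle of that row. -/
structure MidRow (q : ℕ) (al be ga : ℕ → ℤ) (w : List Letter) : Prop where
  partB : RowPart q be (fun k => cum nA k w) (fun k => cum nB k w)
  partC : RowPart q ga (fun k => cum nA k w) (fun k => cum nC k w)
  partA : ∀ e, 1 ≤ e → e < q → cum nA (e + 1) w - cum nA e w = al (e + 1) - al e +
    max (max 0 (be (e + 1) - cum nA e w)) (max 0 (ga (e + 1) - cum nA e w))

theorem cum_hit_of_le (φ : Letter → ℤ) {x z : List Letter} {X : Letter} {j : ℕ} (hj : 1 ≤ j)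
    (hj' : j ≤ x.count Letter.bar) :
    cum φ j (x ++ a :: (z ++ [X])) = cum φ j (a :: (x ++ X :: z)) - φ a := by
  obtain ⟨j, rfl⟩ := Nat.exists_eq_add_of_le' hj
  rw [cum_succ_cons φ (by simp), cum_append_of_le φ _ hj', cum_append_of_le φ _ hj']
  ring

theorem cum_hit_of_lt {φ : Letter → ℤ} (hφ : φ Letter.bar = 0) {x z : List Letter} {X : Letter}
    (hX : X ≠ Letter.bar) {j : ℕ} (hj : x.count Letter.bar < j)
    (hj' : j ≤ x.count Letter.bar + z.count Letter.bar) :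
    cum φ j (x ++ a :: (z ++ [X])) = cum φ j (a :: (x ++ X :: z)) - φ X := by
  obtain ⟨i, rfl⟩ : ∃ i, j = x.count Letter.bar + (i + 1) :=
    ⟨j - x.count Letter.bar - 1, by omega⟩
  rw [cum_append_add hφ, cum_succ_cons φ (by simp), ← add_assoc (x.count Letter.bar),
    cum_succ_cons φ (x := a) (by simp), add_assoc, cum_append_add hφ, cum_succ_cons φ hX,
    cum_append_of_le φ _ (by omega)]
  ring

theorem count_bar_hit {x z : List Letter} {X : Letter} (hX : X ≠ Letter.bar) :
    (a :: (x ++ X :: z)).count Letter.bar = x.count Letter.bar + z.count Letter.bar := by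
  rw [List.count_cons_of_ne (by simp), List.count_append, List.count_cons_of_ne hX]

/-- With `e` bars before the hit letter, removing the leading `a` lowers the counts of `a` up to
bars `1, …, e`; later counts are compensated by the `a` put in block `e + 1`. The appended letter
lies behind the last bar and is not counted. For a hit `d` both deficits grow. -/
theorem MidRow.hit {q : ℕ} {al be ga : ℕ → ℤ} {x z : List Letter} {X : Letter}
    (hw : Standard (a :: (x ++ X :: z))) (hh : Hit x X)
    (hq : (a :: (x ++ X :: z)).count Letter.bar = q) (h : MidRow q al be ga (a :: (x ++ X :: z))) :
    MidRow q al be ga (x ++ a :: (z ++ [X])) := by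
  have hX : X ≠ Letter.bar := by rcases hh.nonpos with rfl | rfl | rfl <;> simp
  obtain ⟨m, r, hz⟩ := hw.hit_next_bar hh
  have hzc : 1 ≤ z.count Letter.bar := by
    rw [hz, List.count_append, List.count_cons_self]; omega
  obtain ⟨he, h1, h2⟩ := hw.cum_hit hh
  have hlt {e : ℕ} (h1 : 1 ≤ e) (h2 : e < x.count Letter.bar) :=
    hw.toTidy.cum_lt_of_safe hh.safe h1 h2
  rw [count_bar_hit hX] at hq
  have hd : X = d → hB x = 0 ∧ hC x = 0 := by
    rintro rfl
    exact hw.good.hit_d hh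
  have hxl := hh.safe.last
  have hhit := hh.hit
  have hcase : ((X.nB = 1 ∧ hB x + 1 + X.u = 0) ∨ (X.nB = 0 ∧ 1 ≤ hB x + 1 + X.u)) ∧
      ((X.nC = 1 ∧ hC x + 1 + X.v = 0) ∨ (X.nC = 0 ∧ 1 ≤ hC x + 1 + X.v)) ∧
      (X.nB = 1 ∨ X.nC = 1) ∧ X.nA = 0 := by
    rcases hh.nonpos with rfl | rfl | rfl <;> simp [nA, nB, nC] at * <;> omega
  set w := a :: (x ++ X :: z) with hwdef
  set w' := x ++ a :: (z ++ [X]) with hwdef'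
  have hA₁ : ∀ j, 1 ≤ j → j ≤ x.count Letter.bar → cum nA j w' = cum nA j w - 1 :=
    fun j h1 h2 => cum_hit_of_le nA h1 h2
  have hA₂ : ∀ j, x.count Letter.bar < j → j ≤ q → cum nA j w' = cum nA j w := by
    intro j h1 h2
    have := cum_hit_of_lt (φ := nA) rfl (z := z) hX h1 (by omega)
    rw [hcase.2.2.2, sub_zero] at this
    exact this
  have hB := h.partB.step (e₀ := x.count Letter.bar) (β := X.nB) (A' := fun k => cum nA k w')
    (B' := fun k => cum nB k w') he (by omega) hA₁ hA₂
    (fun j h1 h2 => by simpa using cum_hit_of_le nB h1 h2)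
    (fun j h1 h2 => cum_hit_of_lt rfl hX h1 (by omega)) (fun e h1 h2 => (hlt h1 h2).1)
    (by omega)
  have hC := h.partC.step (e₀ := x.count Letter.bar) (β := X.nC) (A' := fun k => cum nA k w')
    (B' := fun k => cum nC k w') he (by omega) hA₁ hA₂
    (fun j h1 h2 => by simpa using cum_hit_of_le nC h1 h2)
    (fun j h1 h2 => cum_hit_of_lt rfl hX h1 (by omega)) (fun e h1 h2 => (hlt h1 h2).2)
    (by omega)
  refine ⟨hB.1, hC.1, fun e h1 h2 => ?_⟩
  have hA := h.partA e h1 h2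
  obtain ⟨-, b1, b2, b3⟩ := hB
  obtain ⟨-, c1, c2, c3⟩ := hC
  rcases lt_trichotomy e (x.count Letter.bar) with h4 | rfl | h4
  · have b1 := b1 e h1 h4
    have c1 := c1 e h1 h4
    rw [b1.2, c1.2, hA₁ e h1 h4.le, hA₁ (e + 1) (by omega) (by omega)]
    rw [b1.1, c1.1] at hA
    omega
  · rw [b2, c2, hA₁ _ h1 le_rfl, hA₂ _ (by omega) (by omega)]
    omega
  · rw [hA₂ e h4 h2.le, hA₂ (e + 1) (by omega) (by omega)]
    exact hA

/-- When a bar leads, the first block is used up, and moving the bar shifts the index of all counts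
by one. The deficit relations then rearrange into the recursion. -/
theorem MidRow.bar {q : ℕ} {al be ga : ℕ → ℤ} {x : List Letter}
    (hq : (Letter.bar :: x).count Letter.bar = q) (h : MidRow q al be ga (Letter.bar :: x)) :
    PromotionRow q al be ga (fun k => cum nA k (x ++ [Letter.bar]))
      (fun k => cum nB k (x ++ [Letter.bar])) (fun k => cum nC k (x ++ [Letter.bar])) := by
  rw [List.count_cons_self] at hq
  have e (φ) (k) (hk : k < q) : cum φ k (x ++ [Letter.bar]) = cum φ (k + 1) (Letter.bar :: x) := by
    rw [cum_append_of_le φ _ (by omega), cum_succ_bar]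
  refine ⟨cum_zero _ _, cum_zero _ _, cum_zero _ _, fun k hk => ?_, fun k hk => ?_,
    fun k hk => ?_⟩
  · rw [e _ _ hk, e _ _ (by omega)]
    have : _ = al (k + 2) - al (k + 1) + max (max 0 (be (k + 2) - _)) (max 0 (ga (k + 2) - _)) :=
      h.partA (k + 1) (by omega) hk
    omega
  · rw [e _ _ hk, e _ _ (by omega), e _ _ (by omega)]
    have : _ = be (k + 2) - be (k + 1) - max 0 (be (k + 2) - _) := h.partB.2 (k + 1) (by omega) hk
    simp only at this
    omega
  · rw [e _ _ hk, e _ _ (by omega), e _ _ (by omega)]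
    have : _ = ga (k + 2) - ga (k + 1) - max 0 (ga (k + 2) - _) := h.partC.2 (k + 1) (by omega) hk
    simp only at this
    omega

/-! ### Following a word through the rows -/

/-- The numbers of labels at most `k` of the fibers of a labeling of `V × [ℓ]`. -/
structure Counts (q : ℕ) (ℓ : ℤ) (al be ga : ℕ → ℤ) : Prop where
  al_zero : al 0 = 0
  be_one : be 1 = 0
  ga_one : ga 1 = 0
  be_le : ∀ k, 1 ≤ k → k < q → be (k + 1) ≤ al k
  ga_le : ∀ k, 1 ≤ k → k < q → ga (k + 1) ≤ al k
  al_last : al q = ℓ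
  be_last : be q = ℓ
  ga_last : ga q = ℓ

/-- A word in the middle of the row that starts with the counts `al`, `be`, `ga`. -/
structure InRow (q : ℕ) (ℓ : ℤ) (al be ga : ℕ → ℤ) (w : List Letter) : Prop where
  standard : Standard w
  count_bar : w.count Letter.bar = q
  wt_nA : wt nA w = ℓ
  mid : MidRow q al be ga w
  start : ∀ r, w = r ++ [Letter.bar] → ∀ k, k ≤ q →
    cum nA k w = al k ∧ cum nB k w = be k ∧ cum nC k w = ga k

theorem MidRow.of_start {q : ℕ} {ℓ : ℤ} {al be ga : ℕ → ℤ} {w : List Letter} (hq : 1 ≤ q)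
    (hc : Counts q ℓ al be ga)
    (h : ∀ k, k ≤ q → cum nA k w = al k ∧ cum nB k w = be k ∧ cum nC k w = ga k) :
    MidRow q al be ga w := by
  refine ⟨⟨(h 1 hq).2.1, fun e h1 h2 => ?_⟩, ⟨(h 1 hq).2.2, fun e h1 h2 => ?_⟩, fun e h1 h2 => ?_⟩
  all_goals
    obtain ⟨a1, b1, c1⟩ := h e h2.le
    obtain ⟨a2, b2, c2⟩ := h (e + 1) h2
    have := hc.be_le e h1 h2
    have := hc.ga_le e h1 h2
    beta_reduce
    omega

theorem Step.wt {w w' : List Letter} (h : Step w w') (φ : Letter → ℤ) :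
    VWord.wt φ w' = VWord.wt φ w := by
  cases h <;> simp <;> ring

/-- A hit writes an `a` over a letter that is not a bar, so the pattern of bars only rotates. This
is what allows rows to be counted. -/
theorem Step.map_isBar {y : Letter} {r w' : List Letter} (h : Step (y :: r) w') :
    w'.map (fun x => decide (x = Letter.bar)) =
      r.map (fun x => decide (x = Letter.bar)) ++ [decide (y = Letter.bar)] := by
  obtain ⟨rfl, rfl⟩ | ⟨rfl, x, X, z, rfl, hh, rfl⟩ := Step.inv h
  · simp
  · have hX : X ≠ Letter.bar := by rcases hh.nonpos with rfl | rfl | rfl <;> simp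
    simp [hX]

theorem InRow.step {q : ℕ} {ℓ : ℤ} {al be ga al' be' ga' : ℕ → ℤ} {y : Letter}
    {r w' : List Letter} (hc' : Counts q ℓ al' be' ga')
    (hrow : PromotionRow q al be ga al' be' ga') (h : InRow q ℓ al be ga (y :: r))
    (hs : Step (y :: r) w') :
    if y = Letter.bar then InRow q ℓ al' be' ga' w' else InRow q ℓ al be ga w' := by
  have hst := h.standard.step hs
  have hwt := (hs.wt nA).trans h.wt_nA
  obtain ⟨rfl, rfl⟩ | ⟨rfl, x, X, z, rfl, hh, rfl⟩ := Step.inv hs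
  · rw [if_pos rfl]
    have hq : (r ++ [Letter.bar]).count Letter.bar = q := by
      have := h.count_bar
      simpa using this
    have hq1 : r.count Letter.bar + 1 = q := by simpa using hq
    have key : ∀ k, k ≤ q → cum nA k (r ++ [Letter.bar]) = al' k ∧
        cum nB k (r ++ [Letter.bar]) = be' k ∧ cum nC k (r ++ [Letter.bar]) = ga' k := by
      intro k hk
      rcases hk.lt_or_eq with hk | rfl
      · exact (MidRow.bar h.count_bar h.mid).unique hrow k hk
      -- The recursion says nothing at `k = q`; there the counts are the totals of the word, which
      -- all equal `ℓ` because its heights are `0`.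
      · have e (φ : Letter → ℤ) (hφ : φ Letter.bar = 0) :
            cum φ k (r ++ [Letter.bar]) = wt φ (r ++ [Letter.bar]) := by
          rw [← hq1, cum_append_bar hφ]; simp [hφ]
        have h1 := wt_sub_wt_nB (r ++ [Letter.bar])
        have h2 := wt_sub_wt_nC (r ++ [Letter.bar])
        rw [hst.hB_eq] at h1
        rw [hst.hC_eq] at h2
        rw [e _ rfl, e _ rfl, e _ rfl, hc'.al_last, hc'.be_last, hc'.ga_last]
        omega
    exact ⟨hst, hq, hwt, MidRow.of_start (by omega) hc' key, fun _ _ => key⟩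
  · rw [if_neg (by simp)]
    have hX : X ≠ Letter.bar := by rcases hh.nonpos with rfl | rfl | rfl <;> simp
    refine ⟨hst, ?_, hwt, h.mid.hit h.standard hh h.count_bar, fun r e => ?_⟩
    · have := h.count_bar
      rw [count_bar_hit hX] at this
      rw [List.count_append, List.count_cons_of_ne (by simp), List.count_append,
        List.count_eq_zero_of_not_mem (l := [X]) (by simpa using hX.symm)]
      omega
    · rw [← List.cons_append, ← List.append_assoc] at e
      have := (List.append_inj' e rfl).2
      simp at this
      exact absurd this hX

/-- `M₁` lists which of the next `n` leading letters are bars; by rotation it can be read from the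
initial word, and each `true` completes one row. -/
theorem InRow.steps {q : ℕ} {ℓ : ℤ} {al be ga : ℕ → ℕ → ℤ}
    (hc : ∀ r, Counts q ℓ (al r) (be r) (ga r))
    (hrow : ∀ r, PromotionRow q (al r) (be r) (ga r) (al (r + 1)) (be (r + 1)) (ga (r + 1)))
    {n r : ℕ} {w w' : List Letter} {M₁ M₂ : List Bool} (h : InRow q ℓ (al r) (be r) (ga r) w)
    (hs : Steps n w w') (hw : w.map (fun x => decide (x = Letter.bar)) = M₁ ++ M₂)
    (hn : M₁.length = n) :
    InRow q ℓ (al (r + M₁.count true)) (be (r + M₁.count true)) (ga (r + M₁.count true)) w' := by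
  induction n generalizing w M₁ M₂ r with
  | zero =>
    cases hs
    rw [List.length_eq_zero_iff] at hn
    subst hn
    simpa using h
  | succ n ih =>
    obtain ⟨w₁, s1, s2⟩ := hs
    rcases M₁ with _ | ⟨B, M₁⟩
    · simp at hn
    rcases w with _ | ⟨y, w⟩
    · simp at hw
    simp only [List.map_cons, List.cons_append, List.cons.injEq] at hw
    obtain ⟨rfl, hw⟩ := hw
    have h1 := h.step (hc (r + 1)) (hrow r) s1
    have h2 := s1.map_isBar
    rw [hw, List.append_assoc] at h2
    by_cases hy : y = Letter.bar
    · rw [if_pos hy] at h1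
      have := ih h1 s2 h2 (by simpa using hn)
      simpa [hy, add_assoc, add_comm, add_left_comm] using this
    · rw [if_neg hy] at h1
      have := ih h1 s2 h2 (by simpa using hn)
      simpa [hy] using this

/-- If a standard word has the counts that start a sequence of rows of promotion, then the counts
after `q` rows are the initial ones with `B` and `C` exchanged. -/
theorem counts_after_rows {q : ℕ} {ℓ : ℤ} {al be ga : ℕ → ℕ → ℤ} (hq : 1 ≤ q)
    (hc : ∀ r, Counts q ℓ (al r) (be r) (ga r))
    (hrow : ∀ r, PromotionRow q (al r) (be r) (ga r) (al (r + 1)) (be (r + 1)) (ga (r + 1)))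
    {w : List Letter} (hw : Standard w) (hbar : w.count Letter.bar = q)
    (hlast : ∃ r, w = r ++ [Letter.bar])
    (h : ∀ k, k ≤ q → cum nA k w = al 0 k ∧ cum nB k w = be 0 k ∧ cum nC k w = ga 0 k)
    (k : ℕ) (hk : k ≤ q) : al q k = al 0 k ∧ be q k = ga 0 k ∧ ga q k = be 0 k := by
  obtain ⟨r, rfl⟩ := hlast
  have hwt : wt nA (r ++ [Letter.bar]) = ℓ := by
    have h1 := (h q le_rfl).1
    rw [(hc 0).al_last, ← hbar, List.count_append, List.count_singleton_self,
      cum_append_bar rfl] at h1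
    simpa using h1
  have h0 : InRow q ℓ (al 0) (be 0) (ga 0) (r ++ [Letter.bar]) :=
    ⟨hw, hbar, hwt, MidRow.of_start hq (hc 0) h, fun _ _ => h⟩
  have h1 := h0.steps hc hrow (steps_sw hw.good) (M₂ := [])
    (by rw [List.append_nil]) (by simp)
  have h2 : ((r ++ [Letter.bar]).map (fun x => decide (x = Letter.bar))).count true = q := by
    rw [← hbar, List.count_eq_countP, List.countP_map, List.count_eq_countP]
    congr 1
    funext x
    simp [beq_eq_decide]
  rw [h2, zero_add] at h1
  obtain ⟨e1, e2, e3⟩ := h1.start (sw r) (by simp) k hk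
  obtain ⟨f1, f2, f3⟩ := h k hk
  rw [cum_sw nA_swap] at e1
  rw [cum_sw nB_swap] at e2
  rw [cum_sw nC_swap] at e3
  omega

/-! ### Standard words with given counts -/

theorem Tidy.append_singleton {p : List Letter} {X : Letter} (h : Tidy p)
    (hB0 : 0 ≤ hB p + X.u) (hC0 : 0 ≤ hC p + X.v) (hd : X = d → ¬ LateB p ∧ ¬ LateC p)
    (ha : ∀ p', p = p' ++ [a] → X = a ∨ X = Letter.bar)
    (hb : ∀ p', p = p' ++ [b] → X = c → LateB p')
    (hc : ∀ p', p = p' ++ [c] → X = b → LateC p') : Tidy (p ++ [X]) where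
  safe := by
    have := h.safe.last
    simp
    exact ⟨h.safe, by omega, by omega, hB0, hC0⟩
  merged p' s e := by
    rcases append_singleton_split e with ⟨rfl, rfl, rfl⟩ | ⟨s', rfl, rfl⟩
    · exact hd rfl
    · exact h.merged p' s' rfl
  after_a p' W s e := by
    have e' : p ++ [X] = (p' ++ [a]) ++ W :: s := by simp [e]
    rcases append_singleton_split e' with ⟨rfl, rfl, rfl⟩ | ⟨s', rfl, rfl⟩
    · exact ha p' rfl
    · exact h.after_a p' W s' (by simp)
  lateB p' s e := by
    have e' : p ++ [X] = (p' ++ [b]) ++ c :: s := by simp [e]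
    rcases append_singleton_split e' with ⟨rfl, rfl, rfl⟩ | ⟨s', rfl, rfl⟩
    · exact hb p' rfl rfl
    · exact h.lateB p' s' (by simp)
  lateC p' s e := by
    have e' : p ++ [X] = (p' ++ [c]) ++ b :: s := by simp [e]
    rcases append_singleton_split e' with ⟨rfl, rfl, rfl⟩ | ⟨s', rfl, rfl⟩
    · exact hc p' rfl rfl
    · exact h.lateC p' s' (by simp)

/-- A tidy word can be continued by given numbers of `b` and `c`. -/
theorem Tidy.exists_block (n : ℕ) : ∀ (m₁ m₂ : ℕ) (p : List Letter), m₁ + m₂ = n → Tidy p →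
    (∀ p', p ≠ p' ++ [a]) → (m₁ : ℤ) ≤ hB p → (m₂ : ℤ) ≤ hC p →
    (0 < m₂ → ∀ p', p = p' ++ [b] → LateB p') → (0 < m₁ → ∀ p', p = p' ++ [c] → LateC p') →
    ∃ t, Tidy (p ++ t) ∧ Letter.bar ∉ t ∧ wt nA t = 0 ∧ wt nB t = m₁ ∧ wt nC t = m₂ := by
  induction n using Nat.strong_induction_on with
  | _ n ih =>
    intro m₁ m₂ p hn hp ha h1 h2 hb hc
    have extend (X : Letter) (k₁ k₂ : ℕ) (hX : X ≠ a ∧ X ≠ Letter.bar) (hk : k₁ + k₂ < n)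
        (e1 : (m₁ : ℤ) = k₁ + X.nB) (e2 : (m₂ : ℤ) = k₂ + X.nC) (hT : Tidy (p ++ [X]))
        (hb' : 0 < k₂ → X = b → LateB p) (hc' : 0 < k₁ → X = c → LateC p) :
        ∃ t, Tidy (p ++ t) ∧ Letter.bar ∉ t ∧ wt nA t = 0 ∧ wt nB t = m₁ ∧ wt nC t = m₂ := by
      have last : ∀ {p' : List Letter} {Y : Letter}, p ++ [X] = p' ++ [Y] → p = p' ∧ X = Y := by
        intro p' Y e
        have := List.append_inj' e rfl
        simpa using this
      have hu : X.u = - X.nB ∧ X.v = - X.nC ∧ X.nA = 0 := by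
        cases X <;> simp [nA, nB, nC] at hX ⊢
      obtain ⟨t, t1, t2, t3, t4, t5⟩ := ih _ hk k₁ k₂ (p ++ [X]) rfl hT
        (fun p' e => hX.1 (last e).2) (by simp; omega) (by simp; omega)
        (fun h p' e => (last e).1 ▸ hb' h (last e).2) (fun h p' e => (last e).1 ▸ hc' h (last e).2)
      refine ⟨X :: t, by simpa using t1, ?_, by simp [t3, hu.2.2], by simp [t4]; omega,
        by simp [t5]; omega⟩
      simp only [List.mem_cons, not_or]
      exact ⟨hX.2.symm, t2⟩
    have hl := hp.safe.last
    rcases Nat.eq_zero_or_pos m₁ with rfl | hm₁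
    · rcases Nat.eq_zero_or_pos m₂ with rfl | hm₂
      · exact ⟨[], by simpa using hp, by simp, by simp, by simp, by simp⟩
      · refine extend c 0 (m₂ - 1) (by simp) (by omega) rfl (by simp [nC]; omega) ?_ (by simp)
          (by simp)
        exact hp.append_singleton (by simp; omega) (by simp; omega) (by simp)
          (fun p' e => absurd e (ha p')) (fun p' e _ => hb hm₂ p' e) (by simp)
    · rcases Nat.eq_zero_or_pos m₂ with rfl | hm₂
      · refine extend b (m₁ - 1) 0 (by simp) (by omega) (by simp [nB]; omega) rfl ?_ (by simp)
          (by simp)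
        exact hp.append_singleton (by simp; omega) (by simp; omega) (by simp)
          (fun p' e => absurd e (ha p')) (by simp) (fun p' e _ => hc hm₁ p' e)
      -- The next letter is forced by the matching: `b` if the last unmatched `a` is unmatched for
      -- `b` only, `c` in the mirror case, and `d` if neither holds.
      · by_cases hB1 : LateB p
        · refine extend b (m₁ - 1) m₂ (by simp) (by omega) (by simp [nB]; omega)
            (by simp [nC]) ?_ (fun _ _ => hB1) (by simp)
          exact hp.append_singleton (by simp; omega) (by simp; omega) (by simp)
            (fun p' e => absurd e (ha p')) (by simp) (fun p' e _ => hc hm₁ p' e)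
        by_cases hC1 : LateC p
        · refine extend c m₁ (m₂ - 1) (by simp) (by omega) (by simp [nB])
            (by simp [nC]; omega) ?_ (by simp) (fun _ _ => hC1)
          exact hp.append_singleton (by simp; omega) (by simp; omega) (by simp)
            (fun p' e => absurd e (ha p')) (fun p' e _ => hb hm₂ p' e) (by simp)
        · refine extend d (m₁ - 1) (m₂ - 1) (by simp) (by omega) (by simp [nB]; omega)
            (by simp [nC]; omega) ?_ (by simp) (by simp)
          exact hp.append_singleton (by simp; omega) (by simp; omega) (fun _ => ⟨hB1, hC1⟩)
            (fun p' e => absurd e (ha p')) (by simp) (by simp)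

theorem Tidy.append_replicate_a {p : List Letter} (h : Tidy p) (m : ℕ) :
    Tidy (p ++ List.replicate m a) := by
  induction m with
  | zero => simpa using h
  | succ m ih =>
    have hl := ih.safe.last
    rw [List.replicate_succ', ← List.append_assoc]
    exact ih.append_singleton (by simp only [u_a]; omega) (by simp only [v_a]; omega) (by simp)
      (by simp) (by simp) (by simp)

theorem Tidy.append_bar {p : List Letter} (h : Tidy p) : Tidy (p ++ [Letter.bar]) := by
  have hl := h.safe.last
  exact h.append_singleton (by simp only [u_bar]; omega) (by simp only [v_bar]; omega) (by simp)
    (by simp) (by simp) (by simp)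

/-- Every sequence of counts comes from a standard word. -/
theorem exists_standard {q : ℕ} {ℓ : ℤ} {al be ga : ℕ → ℤ} (hq : 1 ≤ q) (hc : Counts q ℓ al be ga)
    (be_zero : be 0 = 0) (ga_zero : ga 0 = 0) (hal : Monotone al) (hbe : Monotone be)
    (hga : Monotone ga) :
    ∃ w, Standard w ∧ w.count Letter.bar = q ∧ (∃ r, w = r ++ [Letter.bar]) ∧
      ∀ k, k ≤ q → cum nA k w = al k ∧ cum nB k w = be k ∧ cum nC k w = ga k := by
  have key : ∀ k, k ≤ q → ∃ w, Tidy w ∧ w.count Letter.bar = k ∧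
      (w = [] ∧ k = 0 ∨ ∃ r, w = r ++ [Letter.bar]) ∧
      (wt nA w = al k ∧ wt nB w = be k ∧ wt nC w = ga k) ∧
      ∀ j, j ≤ k → cum nA j w = al j ∧ cum nB j w = be j ∧ cum nC j w = ga j := by
    intro k
    induction k with
    | zero =>
      intro _
      refine ⟨[], ⟨by simp, by simp, by simp, by simp, by simp⟩, rfl, Or.inl ⟨rfl, rfl⟩,
        by simp [hc.al_zero, be_zero, ga_zero], fun j hj => ?_⟩
      obtain rfl : j = 0 := by omega
      simp [hc.al_zero, be_zero, ga_zero]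
    | succ k ih =>
      intro hk
      obtain ⟨p, hp, hcount, hend, ⟨w1, w2, w3⟩, hcum⟩ := ih (by omega)
      have hlast : ∀ p' X, X ≠ Letter.bar → p ≠ p' ++ [X] := by
        rintro p' X hX rfl
        rcases hend with ⟨h, -⟩ | ⟨r, h⟩
        · simp at h
        · have := (List.append_inj' h rfl).2
          simp at this
          exact hX this
      have hle : be (k + 1) ≤ al k ∧ ga (k + 1) ≤ al k := by
        rcases Nat.eq_zero_or_pos k with rfl | h
        · simp [hc.be_one, hc.ga_one, hc.al_zero]
        · exact ⟨hc.be_le k h hk, hc.ga_le k h hk⟩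
      have m1 : al k ≤ al (k + 1) := hal (Nat.le_succ k)
      have m2 : be k ≤ be (k + 1) := hbe (Nat.le_succ k)
      have m3 : ga k ≤ ga (k + 1) := hga (Nat.le_succ k)
      have h1 := wt_sub_wt_nB p
      have h2 := wt_sub_wt_nC p
      obtain ⟨t, t1, t2, t3, t4, t5⟩ := Tidy.exists_block _ (be (k + 1) - be k).toNat
        (ga (k + 1) - ga k).toNat p rfl hp (fun p' => hlast p' a (by simp)) (by omega) (by omega)
        (fun _ p' e => absurd e (hlast p' b (by simp)))
        (fun _ p' e => absurd e (hlast p' c (by simp)))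
      set m := (al (k + 1) - al k).toNat with hm
      have hrA : wt nA (List.replicate m a) = m := by simp [wt]
      have hrB : wt nB (List.replicate m a) = 0 := by simp [wt]
      have hrC : wt nC (List.replicate m a) = 0 := by simp [wt]
      have hW : wt nA (p ++ t ++ List.replicate m a) = al (k + 1) ∧
          wt nB (p ++ t ++ List.replicate m a) = be (k + 1) ∧
          wt nC (p ++ t ++ List.replicate m a) = ga (k + 1) := by
        simp only [wt_append]
        omega
      have hcount' : (p ++ t ++ List.replicate m a).count Letter.bar = k := by
        rw [List.count_append, List.count_append, hcount, List.count_eq_zero_of_not_mem t2,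
          List.count_eq_zero_of_not_mem (by simp [List.mem_replicate])]
        rfl
      refine ⟨p ++ t ++ List.replicate m a ++ [Letter.bar],
        (t1.append_replicate_a m).append_bar, ?_, Or.inr ⟨_, rfl⟩, ?_, fun j hj => ?_⟩
      · rw [List.count_append, hcount', List.count_singleton_self]
      · simpa [-List.append_assoc, -wt_append, wt_append _ _ [Letter.bar]] using hW
      · rcases hj.lt_or_eq with hj | rfl
        · have := hcum j (by omega)
          simp only [List.append_assoc]
          rwa [cum_append_of_le _ _ (by omega), cum_append_of_le _ _ (by omega),
            cum_append_of_le _ _ (by omega)]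
        · have hb (φ : Letter → ℤ) (hφ : φ Letter.bar = 0) :=
            cum_append_bar hφ (p ++ t ++ List.replicate m a) []
          rw [hcount'] at hb
          rw [hb _ rfl, hb _ rfl, hb _ rfl]
          exact hW
  obtain ⟨w, hw, h1, h2, ⟨w1, w2, w3⟩, h3⟩ := key q le_rfl
  have hr : ∃ r, w = r ++ [Letter.bar] := h2.resolve_left (by omega)
  refine ⟨w, ⟨hw, ?_, ?_, fun y X e hX => ?_⟩, h1, hr, h3⟩
  · rw [← wt_sub_wt_nB, w1, w2, hc.al_last, hc.be_last, sub_self]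
  · rw [← wt_sub_wt_nC, w1, w3, hc.al_last, hc.ga_last, sub_self]
  · obtain ⟨r, rfl⟩ := hr
    have := (List.append_inj' e rfl).2
    simp at this
    exact absurd this.symm hX

end VWord

/-! ### Counting labels before and after an involution -/

theorem Fin.lt_card_iff_of_lower {ℓ : ℕ} (p : Fin ℓ → Prop) [DecidablePred p]
    (hp : ∀ i j, i ≤ j → p j → p i) (i : Fin ℓ) :
    (i : ℕ) < Finset.card {j : Fin ℓ | p j} ↔ p i := by
  constructor
  · intro h
    by_contra hi
    have hsub : ({j : Fin ℓ | p j} : Finset (Fin ℓ)) ⊆ Finset.Iio i := by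
      intro j hj
      rw [Finset.mem_Iio]
      by_contra hij
      exact hi (hp i j (not_lt.1 hij) (Finset.mem_filter.1 hj).2)
    have := Finset.card_le_card hsub
    rw [Fin.card_Iio] at this
    omega
  · intro h
    have hsub : Finset.Iic i ⊆ ({j : Fin ℓ | p j} : Finset (Fin ℓ)) := by
      intro j hj
      exact Finset.mem_filter.2 ⟨Finset.mem_univ _, hp j i (Finset.mem_Iic.1 hj) h⟩
    have := Finset.card_le_card hsub
    rw [Fin.card_Iic] at this
    omega

theorem Fin.card_filter_interval {ℓ m n : ℕ} (hn : n ≤ ℓ) (p : Fin ℓ → Prop) [DecidablePred p]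
    (hp : ∀ i : Fin ℓ, p i ↔ m ≤ i ∧ (i : ℕ) < n) : Finset.card {i : Fin ℓ | p i} = n - m := by
  rw [← Nat.card_Ico, ← Finset.card_map Fin.valEmbedding]
  congr 1
  ext x
  simp only [Finset.mem_map, Finset.mem_filter, Finset.mem_univ, true_and, Finset.mem_Ico,
    Fin.valEmbedding_apply, hp]
  constructor
  · rintro ⟨i, hi, rfl⟩; exact hi
  · intro hx; exact ⟨⟨x, by omega⟩, hx, rfl⟩

/-- Among the elements of a finite set, those of rank less than `b` number `b`. -/
theorem Finset.card_filter_rank_lt {α : Type*} [LinearOrder α] (s : Finset α) (b : ℕ) :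
    (s.filter fun i => (s.filter (· < i)).card < b).card = min b s.card := by
  induction s using Finset.induction_on_max with
  | empty => simp
  | insert x s hx ih =>
    have hxs : x ∉ s := fun h => lt_irrefl _ (hx x h)
    have e1 : ∀ i ∈ s, ((insert x s).filter (· < i)).card = (s.filter (· < i)).card := by
      intro i hi
      rw [Finset.filter_insert, if_neg (hx i hi).not_gt]
    have e2 : (insert x s).filter (· < x) = s := by
      rw [Finset.filter_insert, if_neg (lt_irrefl x), Finset.filter_true_of_mem hx]
    have e3 : (s.filter fun i => ((insert x s).filter (· < i)).card < b) =
        s.filter fun i => (s.filter (· < i)).card < b :=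
      Finset.filter_congr fun i hi => by rw [e1 i hi]
    rw [Finset.filter_insert, e2, e3, Finset.card_insert_of_notMem hxs]
    split_ifs with h
    · rw [Finset.card_insert_of_notMem (by simp [hxs]), ih]
      omega
    · rw [ih]
      omega

namespace PStrictLabeling

theorem nextLabel_Icc {P : Type*} {R : P → Finset ℤ} {p : P} {s t : ℤ} (hR : R p = Finset.Icc s t)
    {k : ℤ} (hk : s ≤ k)
    (hk' : k < t) : nextLabel R p k = ((k + 1 : ℤ) : WithTop ℤ) := by
  rw [nextLabel_eq_coe, hR]
  exact ⟨Finset.mem_Icc.2 ⟨by omega, by omega⟩, by omega, fun x _ hx => hx⟩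

section General

variable {P : Type*} [PartialOrder P] {ℓ : ℕ} {R : P → Finset ℤ}

/-- The number of labels at most `k` at `p`. -/
def numLe (f : PStrictLabeling P ℓ R) (p : P) (k : ℤ) : ℕ := Finset.card {i : Fin ℓ | f p i ≤ k}

theorem lt_numLe (f : PStrictLabeling P ℓ R) (p : P) (k : ℤ) (i : Fin ℓ) :
    (i : ℕ) < f.numLe p k ↔ f p i ≤ k :=
  Fin.lt_card_iff_of_lower _ (fun _ _ hij h => (f.weak p _ _ hij).trans h) i

theorem numLe_le (f : PStrictLabeling P ℓ R) (p : P) (k : ℤ) : f.numLe p k ≤ ℓ :=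
  (Finset.card_le_univ _).trans (by simp)

theorem numLe_mono (f : PStrictLabeling P ℓ R) (p : P) {k k' : ℤ} (h : k ≤ k') :
    f.numLe p k ≤ f.numLe p k' :=
  Finset.card_le_card fun i hi => by
    simp only [Finset.mem_filter, Finset.mem_univ, true_and] at hi ⊢
    omega

theorem numLe_le_of_lt (f : PStrictLabeling P ℓ R) {p p' : P} (hp : p < p') {k k' : ℤ}
    (h : k' ≤ k + 1) : f.numLe p' k' ≤ f.numLe p k :=
  Finset.card_le_card fun i hi => by
    simp only [Finset.mem_filter, Finset.mem_univ, true_and] at hi ⊢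
    have := f.strict p p' hp i
    omega

theorem numLe_eq_zero (f : PStrictLabeling P ℓ R) {p : P} {k : ℤ} (h : ∀ x ∈ R p, k < x) :
    f.numLe p k = 0 := by
  rw [numLe, Finset.card_eq_zero, Finset.filter_eq_empty_iff]
  intro i _
  exact not_le.2 (h _ (f.mem p i))

theorem numLe_eq (f : PStrictLabeling P ℓ R) {p : P} {k : ℤ} (h : ∀ x ∈ R p, x ≤ k) :
    f.numLe p k = ℓ := by
  rw [numLe, Finset.filter_true_of_mem fun i _ => h _ (f.mem p i)]
  simp

theorem le_iff_of_numLe_eq {f g : PStrictLabeling P ℓ R} {p p' : P} {k : ℤ}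
    (h : f.numLe p k = g.numLe p' k) (i : Fin ℓ) : f p i ≤ k ↔ g p' i ≤ k := by
  rw [← lt_numLe, ← lt_numLe, h]

-- Labels that are not free stay. Among the free ones, exactly those of rank less than the number of
-- free high labels become `k`, so the free low labels counted before are replaced by as many as
-- there were high ones.
open Classical in
theorem numLe_tau (k : ℤ) (f : PStrictLabeling P ℓ R) (p : P) :
    (tau k f).numLe p k + Finset.card {i : Fin ℓ | f.FreeLow k p i} =
      f.numLe p k + Finset.card {i : Fin ℓ | f.FreeHigh k p i} := by
  set F : Finset (Fin ℓ) := {i | f.Free k p i} with hF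
  set bn := Finset.card {i : Fin ℓ | f.FreeHigh k p i} with hb
  have hbF : bn ≤ F.card := Finset.card_le_card fun i hi => by
    simp only [hF, Finset.mem_filter, Finset.mem_univ, true_and] at hi ⊢
    exact Or.inr hi
  have hrank := Finset.card_filter_rank_lt F bn
  rw [min_eq_left hbF] at hrank
  have hr (i : Fin ℓ) : F.filter (· < i) = ({j : Fin ℓ | j < i ∧ f.Free k p j} : Finset _) := by
    ext j; simp [hF, and_comm]
  have e1 : (tau k f).numLe p k = Finset.card {i : Fin ℓ | ¬ f.Free k p i ∧ f p i ≤ k} + bn := by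
    rw [← hrank, ← Finset.card_union_of_disjoint, numLe]
    · congr 1
      ext i
      have hmem : i ∈ F ↔ f.Free k p i := by simp [hF]
      simp only [Finset.mem_filter, Finset.mem_univ, true_and, Finset.mem_union, hr, hmem]
      change tauLabel k f p i ≤ k ↔ _
      by_cases hi : f.Free k p i
      · obtain ⟨-, m, hm, -⟩ := hi.spec
        have := (nextLabel_eq_coe.1 hm).2.1
        unfold tauLabel
        rw [if_pos hi, hm]
        rw [← hb]
        split_ifs with h
        · simp [hi, h]
        · simp [hi, h, this]
      · rw [tauLabel_of_not_free hi]
        simp [hi]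
    · rw [Finset.disjoint_left]
      intro i hi hi'
      simp only [hF, Finset.mem_filter, Finset.mem_univ, true_and] at hi hi'
      exact hi.1 hi'.1
  have e2 : f.numLe p k = Finset.card {i : Fin ℓ | ¬ f.Free k p i ∧ f p i ≤ k} +
      Finset.card {i : Fin ℓ | f.FreeLow k p i} := by
    rw [← Finset.card_union_of_disjoint, numLe]
    · congr 1
      ext i
      simp only [Finset.mem_filter, Finset.mem_univ, true_and, Finset.mem_union]
      by_cases hi : f.Free k p i
      · constructor
        · intro h
          rcases hi with hi | ⟨-, h2, -⟩
          · exact Or.inr hi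
          · have := (nextLabel_eq_coe.1 h2.symm).2.1
            omega
        · rintro (h | h)
          · exact h.2
          · exact h.1.le
      · have : ¬ f.FreeLow k p i := fun h => hi (Or.inl h)
        simp [hi, this]
    · rw [Finset.disjoint_left]
      intro i hi hi'
      simp only [Finset.mem_filter, Finset.mem_univ, true_and] at hi hi'
      exact hi.1 (Or.inl hi')
  omega

/-- In an interval, `τ_k` only trades labels `k` and `k + 1`, which no threshold other than `k`
separates. -/
theorem numLe_tau_of_ne {k j : ℤ} (hj : j ≠ k) (f : PStrictLabeling P ℓ R) {p : P} {s t : ℤ}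
    (hR : R p = Finset.Icc s t) : (tau k f).numLe p j = f.numLe p j := by
  unfold numLe
  congr 1
  ext i
  simp only [Finset.mem_filter, Finset.mem_univ, true_and]
  change tauLabel k f p i ≤ j ↔ _
  by_cases hi : f.Free k p i
  · obtain ⟨h1, m, hm, h2, h3⟩ := hi.spec
    rw [nextLabel_eq_coe, hR] at hm
    rw [hR] at h1
    have h4 := Finset.mem_Icc.1 hm.1
    have h1 := Finset.mem_Icc.1 h1
    have := hm.2.2 (k + 1) (Finset.mem_Icc.2 ⟨by omega, by omega⟩) (by omega)
    omega
  · rw [tauLabel_of_not_free hi]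

open Classical in
/-- The labels at `p` from position `i` on are raised to at least `k`. -/
theorem raisable_of {s t : ℤ} (f : PStrictLabeling P ℓ R) {p : P} {i : Fin ℓ} {k : ℤ}
    (hR : R p = Finset.Icc s t) (hk : f p i < k) (hkt : k ≤ t)
    (h : ∀ p', p < p' → ∀ j, i ≤ j → k < f p' j) : f.Raisable p i := by
  have hs := Finset.mem_Icc.1 (hR ▸ f.mem p i)
  refine ⟨⟨fun p' j => if p' = p ∧ i ≤ j then max (f p' j) k else f p' j, ?_, ?_, ?_⟩, ?_, ?_⟩
  · intro p₁ p₂ h12 j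
    have hf := f.strict p₁ p₂ h12 j
    have hne := h12.ne
    by_cases h1 : p₁ = p
    · subst h1
      have := h p₂ h12 j
      simp only [hne.symm, true_and, false_and, if_false]
      split_ifs with hij
      · have := this hij; omega
      · exact hf
    · simp only [h1, false_and, if_false]
      split_ifs <;> omega
  · intro p' i₁ i₂ h12
    have hf := f.weak p' i₁ i₂ h12
    by_cases hp : p' = p
    · simp only [hp, true_and] at hf ⊢
      split_ifs with h1 h2 h2
      · omega
      · exact absurd (h1.trans h12) h2
      · omega
      · exact hf
    · simpa [hp] using hf
  · intro p' j
    have hf := f.mem p' j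
    split_ifs with h1
    · obtain ⟨rfl, h1⟩ := h1
      rw [hR] at hf ⊢
      have := Finset.mem_Icc.1 hf
      rw [Finset.mem_Icc]
      omega
    · exact hf
  · simp only [le_refl, and_self, if_true]
    omega
  · intro p' hp' j
    simp [hp']

open Classical in
/-- The labels at `p` up to position `i` are lowered to at most `k`. -/
theorem lowerable_of {s t : ℤ} (f : PStrictLabeling P ℓ R) {p : P} {i : Fin ℓ} {k : ℤ}
    (hR : R p = Finset.Icc s t) (hk : k < f p i) (hks : s ≤ k)
    (h : ∀ p', p' < p → ∀ j, j ≤ i → f p' j < k) : f.Lowerable p i := by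
  have hs := Finset.mem_Icc.1 (hR ▸ f.mem p i)
  refine ⟨⟨fun p' j => if p' = p ∧ j ≤ i then min (f p' j) k else f p' j, ?_, ?_, ?_⟩, ?_, ?_⟩
  · intro p₁ p₂ h12 j
    have hf := f.strict p₁ p₂ h12 j
    have hne := h12.ne
    by_cases h1 : p₂ = p
    · subst h1
      have := h p₁ h12 j
      simp only [hne, true_and, false_and, if_false]
      split_ifs with hij
      · have := this hij; omega
      · exact hf
    · simp only [h1, false_and, if_false]
      split_ifs <;> omega
  · intro p' i₁ i₂ h12
    have hf := f.weak p' i₁ i₂ h12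
    by_cases hp : p' = p
    · simp only [hp, true_and] at hf ⊢
      split_ifs with h1 h2 h2
      · omega
      · omega
      · exact absurd (h12.trans h2) h1
      · exact hf
    · simpa [hp] using hf
  · intro p' j
    have hf := f.mem p' j
    split_ifs with h1
    · obtain ⟨rfl, h1⟩ := h1
      rw [hR] at hf ⊢
      have := Finset.mem_Icc.1 hf
      rw [Finset.mem_Icc]
      omega
    · exact hf
  · simp only [le_refl, and_self, if_true]
    omega
  · intro p' hp' j
    simp [hp']

end General

end PStrictLabeling

/-! ### The involutions and promotion for `V` -/

theorem VPoset.A_lt {p : VPoset} (hp : p ≠ A) : A < p := (lt_def _ _).2 ⟨rfl, hp⟩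

namespace PStrictLabeling

open VPoset

section V

variable {ℓ q : ℕ} {R : VPoset → Finset ℤ}

/-- Raising a label at `A` forces later labels there up to at least `k + 1` as well, but the labels
at `B` and `C` increase weakly along the fiber, so the condition at position `i` suffices. -/
theorem freeLow_A (hA : R A = Finset.Icc 1 ((q : ℤ) - 1))
    (hR : ∀ p, p ≠ A → R p = Finset.Icc 2 (q : ℤ))
    (f : PStrictLabeling VPoset ℓ R) (k : ℤ) (i : Fin ℓ) :
    f.FreeLow k A i ↔ f A i = k ∧ k + 1 < f B i ∧ k + 1 < f C i := by
  constructor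
  · rintro ⟨h1, g, hg, hgf⟩
    have b1 := g.strict A B (VPoset.A_lt (by simp)) i
    have c1 := g.strict A C (VPoset.A_lt (by simp)) i
    have b2 := hgf B (by simp) i
    have c2 := hgf C (by simp) i
    omega
  · rintro ⟨h1, h2, h3⟩
    have hB := Finset.mem_Icc.1 (hR B (by simp) ▸ f.mem B i)
    refine ⟨h1, f.raisable_of (k := k + 1) hA (by omega) (by omega) fun p' hp' j hij => ?_⟩
    rw [VPoset.lt_def] at hp'
    have b1 := f.weak B i j hij
    have c1 := f.weak C i j hij
    cases p'
    · exact absurd rfl hp'.2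
    · omega
    · omega

theorem freeHigh_A (hA : R A = Finset.Icc 1 ((q : ℤ) - 1)) (f : PStrictLabeling VPoset ℓ R) {k : ℤ}
    (hk : 1 ≤ k) (i : Fin ℓ) : f.FreeHigh k A i ↔ f A i = k + 1 := by
  have hm := Finset.mem_Icc.1 (hA ▸ f.mem A i)
  constructor
  · rintro ⟨h1, h2, -⟩
    have h1 := Finset.mem_Icc.1 (hA ▸ h1)
    have h3 := nextLabel_eq_coe.1 h2.symm
    have := h3.2.2 (k + 1) (hA ▸ Finset.mem_Icc.2 ⟨by omega, by omega⟩) (by omega)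
    omega
  · intro h
    refine ⟨hA ▸ Finset.mem_Icc.2 ⟨hk, by omega⟩, ?_, f.lowerable_of (k := k) hA (by omega) hk
      fun p' hp' => ?_⟩
    · rw [nextLabel_Icc hA hk (by omega), h]
    · rw [VPoset.lt_def] at hp'
      exact absurd rfl hp'.2

theorem freeLow_of_ne {p : VPoset} (hp : p ≠ A) (hR : R p = Finset.Icc 2 (q : ℤ))
    (f : PStrictLabeling VPoset ℓ R) {k : ℤ} (hk : k < q) (i : Fin ℓ) :
    f.FreeLow k p i ↔ f p i = k := by
  refine ⟨fun h => h.1, fun h => ⟨h, f.raisable_of (k := k + 1) hR (by omega) (by omega)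
    fun p' hp' => ?_⟩⟩
  rw [VPoset.lt_def] at hp'
  exact absurd hp'.1 hp

theorem freeHigh_of_ne {p : VPoset} (hp : p ≠ A) (hA : R A = Finset.Icc 1 ((q : ℤ) - 1))
    (hR : R p = Finset.Icc 2 (q : ℤ)) (f : PStrictLabeling VPoset ℓ R) {k : ℤ} (i : Fin ℓ) :
    f.FreeHigh k p i ↔ f p i = k + 1 ∧ f A i < k := by
  have hm := Finset.mem_Icc.1 (hR ▸ f.mem p i)
  have hmA := Finset.mem_Icc.1 (hA ▸ f.mem A i)
  constructor
  · rintro ⟨h1, h2, g, hg, hgf⟩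
    have h1 := Finset.mem_Icc.1 (hR ▸ h1)
    have h3 := nextLabel_eq_coe.1 h2.symm
    have := h3.2.2 (k + 1) (hR ▸ Finset.mem_Icc.2 ⟨by omega, by omega⟩) (by omega)
    have h4 := g.strict A p (VPoset.A_lt hp) i
    have h5 := hgf A hp.symm i
    omega
  · rintro ⟨h, h'⟩
    refine ⟨hR ▸ Finset.mem_Icc.2 ⟨by omega, by omega⟩, ?_, f.lowerable_of (k := k) hR (by omega)
      (by omega) fun p' hp' j hij => ?_⟩
    · rw [nextLabel_Icc hR (by omega) (by omega), h]
    · rw [VPoset.lt_def] at hp'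
      obtain ⟨rfl, -⟩ := hp'
      have := f.weak A j i hij
      omega

/-- The free labels `k` at `A` fill the positions from the maximum up to `numLe A k`, since raising
is blocked by `B` and `C`. All labels `k + 1` are free, because nothing lies below `A`. -/
theorem numLe_tau_A (hA : R A = Finset.Icc 1 ((q : ℤ) - 1))
    (hR : ∀ p, p ≠ A → R p = Finset.Icc 2 (q : ℤ)) (f : PStrictLabeling VPoset ℓ R) {k : ℤ}
    (hk : 1 ≤ k) :
    ((tau k f).numLe A k : ℤ) + f.numLe A k = f.numLe A (k + 1) +
      max (f.numLe A (k - 1) : ℤ) (max (f.numLe B (k + 1) : ℤ) (f.numLe C (k + 1))) := by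
  classical
  have h := numLe_tau k f A
  have h1 := Fin.card_filter_interval (f.numLe_le A k)
    (m := max (f.numLe A (k - 1)) (max (f.numLe B (k + 1)) (f.numLe C (k + 1))))
    (fun i => f.FreeLow k A i) fun i => by
      rw [freeLow_A hA hR, lt_numLe, max_le_iff, max_le_iff, ← not_lt, ← not_lt, ← not_lt,
        lt_numLe, lt_numLe, lt_numLe]
      omega
  have h2 := Fin.card_filter_interval (f.numLe_le A (k + 1)) (m := f.numLe A k)
    (fun i => f.FreeHigh k A i) fun i => by
      rw [freeHigh_A hA f hk, lt_numLe, ← not_lt, lt_numLe]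
      omega
  have m1 := f.numLe_mono A (show k - 1 ≤ k by omega)
  have m2 := f.numLe_mono A (show k ≤ k + 1 by omega)
  have m3 := f.numLe_le_of_lt (VPoset.A_lt (p := B) (by simp)) (le_refl (k + 1))
  have m4 := f.numLe_le_of_lt (VPoset.A_lt (p := C) (by simp)) (le_refl (k + 1))
  rw [h1, h2] at h
  omega

/-- Dually, every label `k` can be raised, while a label `k + 1` can be lowered only where the label
at `A` is below `k`; this gives the minimum. -/
theorem numLe_tau_of_ne_A {p : VPoset} (hp : p ≠ A) (hA : R A = Finset.Icc 1 ((q : ℤ) - 1))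
    (hR : R p = Finset.Icc 2 (q : ℤ)) (f : PStrictLabeling VPoset ℓ R) {k : ℤ} (hk : k < q) :
    ((tau k f).numLe p k : ℤ) + f.numLe p k =
      f.numLe p (k - 1) + min (f.numLe p (k + 1) : ℤ) (f.numLe A (k - 1)) := by
  classical
  have h := numLe_tau k f p
  have h1 := Fin.card_filter_interval (f.numLe_le p k) (m := f.numLe p (k - 1))
    (fun i => f.FreeLow k p i) fun i => by
      rw [freeLow_of_ne hp hR f hk, lt_numLe, ← not_lt, lt_numLe]
      omega
  have h2 := Fin.card_filter_interval
    ((min_le_left (f.numLe p (k + 1)) (f.numLe A (k - 1))).trans (f.numLe_le p (k + 1)))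
    (m := f.numLe p k) (fun i => f.FreeHigh k p i) fun i => by
      rw [freeHigh_of_ne hp hA hR f, lt_min_iff, lt_numLe, ← not_lt, lt_numLe, lt_numLe]
      omega
  have m1 := f.numLe_mono p (show k - 1 ≤ k by omega)
  have m2 := f.numLe_mono p (show k ≤ k + 1 by omega)
  have m3 := f.numLe_le_of_lt (VPoset.A_lt hp) (show k ≤ k - 1 + 1 by omega)
  rw [h1, h2] at h
  omega

theorem exists_Icc (hA : R A = Finset.Icc 1 ((q : ℤ) - 1))
    (hR : ∀ p, p ≠ A → R p = Finset.Icc 2 (q : ℤ)) (p : VPoset) :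
    ∃ s t, R p = Finset.Icc s t := by
  by_cases hp : p = A
  · exact ⟨_, _, hp ▸ hA⟩
  · exact ⟨_, _, hR p hp⟩

theorem numLe_tauComposite_of_lt (hA : R A = Finset.Icc 1 ((q : ℤ) - 1))
    (hR : ∀ p, p ≠ A → R p = Finset.Icc 2 (q : ℤ)) (f : PStrictLabeling VPoset ℓ R) (p : VPoset)
    (n : ℕ) {j : ℤ} (hj : n < j) : (tauComposite n f).numLe p j = f.numLe p j := by
  obtain ⟨s, t, hst⟩ := exists_Icc hA hR p
  induction n with
  | zero => rfl
  | succ n ih =>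
    rw [tauComposite, numLe_tau_of_ne (by push_cast at hj; omega) _ hst,
      ih (by push_cast at hj; omega)]

theorem numLe_tauComposite_of_le (hA : R A = Finset.Icc 1 ((q : ℤ) - 1))
    (hR : ∀ p, p ≠ A → R p = Finset.Icc 2 (q : ℤ)) (f : PStrictLabeling VPoset ℓ R) (p : VPoset)
    {j n : ℕ} (hj : j ≤ n) : (tauComposite n f).numLe p j = (tauComposite j f).numLe p j := by
  obtain ⟨s, t, hst⟩ := exists_Icc hA hR p
  induction n, hj using Nat.le_induction with
  | base => rfl
  | succ n hn ih =>
    rw [tauComposite, numLe_tau_of_ne (by omega) _ hst, ih]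

/-- The count at threshold `j` changes only when `τ_j` acts. So when `τ_{k+1}` acts, the count at
`k` is already final and those at `k + 1` and `k + 2` are still the original ones, which turns the
formulas for one involution into the recursion. -/
theorem promotionRow_tauComposite (hA : R A = Finset.Icc 1 ((q : ℤ) - 1))
    (hR : ∀ p, p ≠ A → R p = Finset.Icc 2 (q : ℤ)) (f : PStrictLabeling VPoset ℓ R) :
    PromotionRow q (fun k => f.numLe A k) (fun k => f.numLe B k) (fun k => f.numLe C k)
      (fun k => (tauComposite (q - 1) f).numLe A k) (fun k => (tauComposite (q - 1) f).numLe B k)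
      (fun k => (tauComposite (q - 1) f).numLe C k) := by
  have zero (p : VPoset) : ((tauComposite (q - 1) f).numLe p (0 : ℕ) : ℤ) = 0 := by
    rw [Nat.cast_eq_zero]
    refine numLe_eq_zero _ fun x hx => ?_
    by_cases hp : p = A
    · subst hp
      have := Finset.mem_Icc.1 (hA ▸ hx)
      push_cast; omega
    · have := Finset.mem_Icc.1 (hR p hp ▸ hx)
      push_cast; omega
  have reduce (p : VPoset) {k : ℕ} (hk : k + 1 < q) :
      (tauComposite (q - 1) f).numLe p ((k + 1 : ℕ) : ℤ) =
        (tau (k + 1 : ℤ) (tauComposite k f)).numLe p (k + 1 : ℤ) ∧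
      (tauComposite (q - 1) f).numLe p (k : ℤ) = (tauComposite k f).numLe p (k + 1 - 1 : ℤ) ∧
      f.numLe p ((k + 1 : ℕ) : ℤ) = (tauComposite k f).numLe p (k + 1 : ℤ) ∧
      f.numLe p ((k + 2 : ℕ) : ℤ) = (tauComposite k f).numLe p (k + 1 + 1 : ℤ) := by
    refine ⟨?_, ?_, ?_, ?_⟩
    · rw [numLe_tauComposite_of_le hA hR f p (show k + 1 ≤ q - 1 by omega)]
      push_cast; rfl
    · rw [numLe_tauComposite_of_le hA hR f p (show k ≤ q - 1 by omega), add_sub_cancel_right]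
    · rw [numLe_tauComposite_of_lt hA hR f p k (by omega)]
      push_cast; rfl
    · rw [numLe_tauComposite_of_lt hA hR f p k (by omega)]
      push_cast; rw [add_assoc]; norm_num
  refine ⟨zero A, zero B, zero C, fun k hk => ?_, fun k hk => ?_, fun k hk => ?_⟩
  · obtain ⟨a1, a2, a3, a4⟩ := reduce A hk
    rw [a1, a2, a3, a4, (reduce B hk).2.2.2, (reduce C hk).2.2.2]
    exact numLe_tau_A hA hR _ (by omega)
  · obtain ⟨a1, a2, a3, a4⟩ := reduce B hk
    rw [a1, a2, a3, a4, (reduce A hk).2.1]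
    exact numLe_tau_of_ne_A (by simp) hA (hR B (by simp)) _ (by omega)
  · obtain ⟨a1, a2, a3, a4⟩ := reduce C hk
    rw [a1, a2, a3, a4, (reduce A hk).2.1]
    exact numLe_tau_of_ne_A (by simp) hA (hR C (by simp)) _ (by omega)

theorem counts_numLe (hA : R A = Finset.Icc 1 ((q : ℤ) - 1))
    (hR : ∀ p, p ≠ A → R p = Finset.Icc 2 (q : ℤ)) (f : PStrictLabeling VPoset ℓ R) :
    VWord.Counts q ℓ (fun k => f.numLe A k) (fun k => f.numLe B k) (fun k => f.numLe C k) where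
  al_zero := by
    rw [Nat.cast_eq_zero]
    refine f.numLe_eq_zero fun x hx => ?_
    have := Finset.mem_Icc.1 (hA ▸ hx)
    push_cast; omega
  be_one := by
    rw [Nat.cast_eq_zero]
    refine f.numLe_eq_zero fun x hx => ?_
    have := Finset.mem_Icc.1 (hR B (by simp) ▸ hx)
    push_cast; omega
  ga_one := by
    rw [Nat.cast_eq_zero]
    refine f.numLe_eq_zero fun x hx => ?_
    have := Finset.mem_Icc.1 (hR C (by simp) ▸ hx)
    push_cast; omega
  be_le k _ _ := by
    rw [Nat.cast_le]
    exact f.numLe_le_of_lt (VPoset.A_lt (by simp)) (by push_cast; omega)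
  ga_le k _ _ := by
    rw [Nat.cast_le]
    exact f.numLe_le_of_lt (VPoset.A_lt (by simp)) (by push_cast; omega)
  al_last := by
    rw [Nat.cast_inj]
    refine f.numLe_eq fun x hx => ?_
    have := Finset.mem_Icc.1 (hA ▸ hx)
    omega
  be_last := by
    rw [Nat.cast_inj]
    refine f.numLe_eq fun x hx => ?_
    exact (Finset.mem_Icc.1 (hR B (by simp) ▸ hx)).2
  ga_last := by
    rw [Nat.cast_inj]
    refine f.numLe_eq fun x hx => ?_
    exact (Finset.mem_Icc.1 (hR C (by simp) ▸ hx)).2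

theorem numLe_iterate_tauComposite (hq : 1 ≤ q) (hA : R A = Finset.Icc 1 ((q : ℤ) - 1))
    (hR : ∀ p, p ≠ A → R p = Finset.Icc 2 (q : ℤ)) (f : PStrictLabeling VPoset ℓ R)
    (k : ℕ) (hk : k ≤ q) :
    ((tauComposite (q - 1))^[q] f).numLe A k = f.numLe A k ∧
      ((tauComposite (q - 1))^[q] f).numLe B k = f.numLe C k ∧
      ((tauComposite (q - 1))^[q] f).numLe C k = f.numLe B k := by
  have hc (r : ℕ) := counts_numLe hA hR ((tauComposite (q - 1))^[r] f)
  have hrow (r : ℕ) := promotionRow_tauComposite hA hR ((tauComposite (q - 1))^[r] f)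
  simp only [← Function.iterate_succ_apply'] at hrow
  have hmono (p : VPoset) : Monotone fun k : ℕ => (f.numLe p k : ℤ) := fun m n hmn => by
    simp only [Nat.cast_le]
    exact f.numLe_mono p (by exact_mod_cast hmn)
  have zero {p : VPoset} (hp : p ≠ A) : (f.numLe p (0 : ℕ) : ℤ) = 0 := by
    rw [Nat.cast_eq_zero]
    refine f.numLe_eq_zero fun x hx => ?_
    have := Finset.mem_Icc.1 (hR p hp ▸ hx)
    push_cast; omega
  obtain ⟨w, hw, hbar, hlast, hcum⟩ := VWord.exists_standard hq (hc 0) (zero (p := B) (by simp))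
    (zero (p := C) (by simp)) (hmono A) (hmono B) (hmono C)
  have := VWord.counts_after_rows hq hc hrow hw hbar hlast hcum k hk
  simpa using this

theorem eq_of_numLe_eq (hA : R A = Finset.Icc 1 ((q : ℤ) - 1))
    (hR : ∀ p, p ≠ A → R p = Finset.Icc 2 (q : ℤ)) {f g : PStrictLabeling VPoset ℓ R}
    {p p' : VPoset} (h : ∀ k : ℕ, k ≤ q → f.numLe p k = g.numLe p' k) (i : Fin ℓ) :
    f p i = g p' i := by
  have range (p : VPoset) (f : PStrictLabeling VPoset ℓ R) : 0 ≤ f p i ∧ f p i ≤ q := by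
    by_cases hp : p = A
    · subst hp
      have := Finset.mem_Icc.1 (hA ▸ f.mem A i)
      omega
    · have := Finset.mem_Icc.1 (hR p hp ▸ f.mem p i)
      omega
  have h1 := range p f
  have h2 := range p' g
  -- Comparing at the two labels themselves as thresholds gives both inequalities; they are natural
  -- numbers at most `q`, so `h` applies.
  have e1 := le_iff_of_numLe_eq (h (f p i).toNat (by omega)) i
  have e2 := le_iff_of_numLe_eq (h (g p' i).toNat (by omega)) i
  omega

end V

end PStrictLabeling

/-! ### The order of promotion -/

theorem Function.End.pow_apply {α : Type*} (g : Function.End α) (n : ℕ) (x : α) :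
    (g ^ n : Function.End α) x = g^[n] x := by
  induction n generalizing x with
  | zero => rfl
  | succ n ih => exact (congrArg (fun h : Function.End α => h x) (pow_succ g n)).trans (ih (g x))

/-- The order of `P`-strict promotion on the `V`-strict labelings of `V × [ℓ]` with labels in `[q]`
divides `2 q`; moreover the `q`-th power of promotion exchanges the labels at `B` and `C`. -/
theorem theorem1 (ℓ q : ℕ) (hℓ : 1 ≤ ℓ) (hq : 3 ≤ q) :
    orderOf (PStrictLabeling.promotion VPoset ℓ q) ∣ 2 * q ∧
    ∀ (f : PStrictLabeling VPoset ℓ (PStrictLabeling.restrictionQ VPoset ℓ q)) (i : Fin ℓ),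
      ((PStrictLabeling.promotion VPoset ℓ q)^[q] f) VPoset.A i = f VPoset.A i ∧
      ((PStrictLabeling.promotion VPoset ℓ q)^[q] f) VPoset.B i = f VPoset.C i ∧
      ((PStrictLabeling.promotion VPoset ℓ q)^[q] f) VPoset.C i = f VPoset.B i := by
  have hA : PStrictLabeling.restrictionQ VPoset ℓ q VPoset.A = Finset.Icc 1 ((q : ℤ) - 1) := by
    rw [PStrictLabeling.restrictionQ_VPoset hℓ, if_pos rfl]
  have hR : ∀ p, p ≠ VPoset.A →
      PStrictLabeling.restrictionQ VPoset ℓ q p = Finset.Icc 2 (q : ℤ) := fun p hp => by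
    rw [PStrictLabeling.restrictionQ_VPoset hℓ, if_neg hp]
  have key : ∀ (f : PStrictLabeling VPoset ℓ (PStrictLabeling.restrictionQ VPoset ℓ q))
      (i : Fin ℓ),
      ((PStrictLabeling.promotion VPoset ℓ q)^[q] f) VPoset.A i = f VPoset.A i ∧
      ((PStrictLabeling.promotion VPoset ℓ q)^[q] f) VPoset.B i = f VPoset.C i ∧
      ((PStrictLabeling.promotion VPoset ℓ q)^[q] f) VPoset.C i = f VPoset.B i := by
    intro f i
    have h := PStrictLabeling.numLe_iterate_tauComposite (by omega) hA hR f
    exact ⟨PStrictLabeling.eq_of_numLe_eq hA hR (fun k hk => (h k hk).1) i,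
      PStrictLabeling.eq_of_numLe_eq hA hR (fun k hk => (h k hk).2.1) i,
      PStrictLabeling.eq_of_numLe_eq hA hR (fun k hk => (h k hk).2.2) i⟩
  refine ⟨orderOf_dvd_of_pow_eq_one ?_, key⟩
  funext f
  refine (Function.End.pow_apply _ _ _).trans ?_
  rw [two_mul]
  refine (Function.iterate_add_apply _ q q f).trans ?_
  apply PStrictLabeling.ext
  funext p i
  obtain ⟨a1, b1, c1⟩ := key ((PStrictLabeling.promotion VPoset ℓ q)^[q] f) i
  obtain ⟨a2, b2, c2⟩ := key f i
  cases p
  · exact a1.trans a2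
  · exact b1.trans c2
  · exact c1.trans b2
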